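/- Notation. Let $L>0$. Matrices are complex $2\times2$, $[A,B]=BA-AB$, $K=SU_2$, $\mathfrak k$ (resp. $\mathfrak h$) is the space of trace-zero skew-Hermitian (resp. Hermitian) matrices, $A_1=\tfrac12\mathrm{diag}(i,-i)$, $B_1=\tfrac12\mathrm{diag}(1,-1)$; $\langle A,B\rangle=2\,\mathrm{Tr}(AB)$ in the hyperbolic and Euclidean cases and $\langle A,B\rangle=-2\,\mathrm{Tr}(AB)$ in the spherical case. Let $R:\mathbb R\to K$ denote a smooth curve (the frame). Consider smooth curves of the following kinds, extended to $s\in\mathbb R$. * Hyperbolic: $g$ in $SL_2(\mathbb C)$, $g(0)=I$, $\Lambda=g^{-1}\frac{dg}{ds}=RB_1R^*$ for some $R$, $\Lambda$ $L$-periodic. * Spherical: $X$ in $SU_2$, $X(0)=I$, $\Lambda=X^*\frac{dX}{ds}=RA_1R^*$ for some $L$-periodic $R$. * Euclidean: $x$ in $\mathfrak h$, $x(0)=0$, $\Lambda=\frac{dx}{ds}=RB_1R^*$ for some $L$-periodic $R$. In each case let $\mathcal M$ be the space of all such curves, and $\mathcal M_0\subset\mathcal M$ the space of those for which $R$ can be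 chosen with $R(0)=I$ (the frame-periodic anchored horizontal Darboux curves). A smooth curve in $\mathcal M$ or $\mathcal M_0$ is a family, smooth in $(s,t)$, $t$ in an open set $J\subset\mathbb R$, of curves in that space; $\Lambda(s,t)$ denotes its tangents. Its velocity is represented by a matrix curve $V$ as follows: in the spherical case $\partial_tX=XV$; in the Euclidean case $\partial_tx=V$; in the hyperbolic case $V$ (the tangent vector is then written $gV$) is the curve with $V(0)=0$ whose covariant derivative $\frac{dV}{ds}$ along $g$ is the variation $\partial_t\Lambda$. Tangent vectors are the velocities of smooth curves in the space. Put $$\omega(V_1,V_2)=\frac1i\int_0^L\Big\langle\Lambda,\Big[\frac{dV_1}{ds},\frac{dV_2}{ds}\Big]\Big\rangle ds\ \text{(hyperbolic, Euclidean)},\qquad \omega(V_1,V_2)=-\int_0^L\langle\Lambda,[U_1,U_2]\rangle ds,\ U_j=\frac{dV_j}{ds}-[\Lambda,V_j]\ \text{(spherical)},$$ and $f=\frac12\int_0^L\kappa^2\,ds$, where $\kappa=\|\Lambda'\|$ in the hyperbolic and Euclidean cases and $\kappa=\|\Lambda'+\frac12[\Lambda,\Lambda]\|=\|\Lambda'\|$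 in the spherical case is the curvature (the norm of the covariant derivative of the tangent). A tangent vector $F$ is the value at a curve of the Hamiltonian vector field of $f$ on one of the spaces if $df(V)=\omega(F,V)$ for all tangent vectors $V$ of that space there; an integral curve of this field is a smooth curve in the space whose velocity at each time is the Hamiltonian vector. Let $F$ be the curve $$F(s)=i\int_0^s[\Lambda'',\Lambda]\,dx\ \text{(hyperbolic and Euclidean)},\qquad \frac{dF}{ds}=[\Lambda,F]-[\Lambda,\Lambda''],\ F(0)=0\ \text{(spherical; there is exactly one such }F).$$ Theorem. In each of the three cases: 1. At every curve in $\mathcal M_0$, $F$ satisfies $df(V)=\omega(F,V)$ for all tangent vectors $V$ of $\mathcal M_0$, and it is the only tangent vector of $\mathcal M$ there with this property. It is tangent to $\mathcal M_0$ (and thus the Hamiltonian vector on $\mathcal M_0$) if and only if $[\Lambda''(0),\Lambda(0)]=0$. 2. At every curve in $\mathcal M$ the Hamiltonian vector of $f$ on $\mathcal M$ exists, is unique, and equals $F$; that is, in the hyperbolic case the Hamiltonian vector field is $g\mapsto gF$. 3. A smooth curve in $\mathcal M$ (respectively in $\mathcal M_0$) is an integral curve of the Hamiltonian vector field of $f$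 on that space if and only if its tangents evolve by Heisenberg's magnetic equation $$\frac{\partial\Lambda}{\partial t}=i\Big[\frac{\partial^2\Lambda}{\partial s^2},\Lambda\Big]\ \text{(hyperbolic and Euclidean)},\qquad \frac{\partial\Lambda}{\partial t}=\Big[\frac{\partial^2\Lambda}{\partial s^2},\Lambda\Big]\ \text{(spherical)}.$$ 4. In the hyperbolic case, every smooth curve in $\mathcal M$ that satisfies $\partial_tg=gF$ literally, as an equation of matrices, also evolves by $\frac{\partial\Lambda}{\partial t}=i[\frac{\partial^2\Lambda}{\partial s^2},\Lambda]$. -/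

import Mathlib

open scoped Matrix ContDiff

noncomputable section

namespace Darboux

/-! ## Linear algebra -/

/-- Complex `2 × 2` matrices. -/
abbrev M2 : Type := Matrix (Fin 2) (Fin 2) ℂ

/-- The group `K = SU₂`. -/
abbrev SU2 : Set M2 := {R | R ∈ Matrix.specialUnitaryGroup (Fin 2) ℂ}

/-- The Lie bracket, with the sign convention `[A, B] = BA - AB`. -/
def br (A B : M2) : M2 := B * A - A * B

/-- The first skew-Hermitian Pauli matrix. -/
def A1 : M2 := (1 / 2 : ℂ) • !![Complex.I, 0; 0, -Complex.I]

/-- The first Hermitian Pauli matrix. -/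
def B1 : M2 := (1 / 2 : ℂ) • !![1, 0; 0, -1]

/-- The trace form `⟨A, B⟩ = 2 Tr(AB)` on `sl₂(ℂ)`, positive definite on Hermitian matrices. -/
def trH (A B : M2) : ℂ := 2 * (A * B).trace

/-- The trace form `⟨A, B⟩ = -2 Tr(AB)`, positive definite on skew-Hermitian matrices. -/
def trK (A B : M2) : ℂ := -2 * (A * B).trace

/-! ## Calculus of matrix-valued functions, entry by entry -/

/-- Smooth curves of matrices. -/
def SmoothCurve (A : ℝ → M2) : Prop := ∀ i j, ContDiff ℝ ∞ (fun s => A s i j)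

/-- The derivative `dA/ds`. -/
def dd (A : ℝ → M2) (s : ℝ) : M2 := Matrix.of fun i j => deriv (fun x => A x i j) s

/-- `A` is differentiable at `s` with derivative `D`. -/
def HasDD (A : ℝ → M2) (D : M2) (s : ℝ) : Prop :=
  ∀ i j, HasDerivAt (fun x => A x i j) (D i j) s

/-- `∫₀ˢ A(x) dx`. -/
def intM (A : ℝ → M2) (s : ℝ) : M2 := Matrix.of fun i j => ∫ x in (0 : ℝ)..s, A x i j

/-! ## Spaces of curves, tangent vectors, Hamiltonian vectors -/

/-- `t ↦ σ t`, `t ∈ J`, is a smooth curve in the space of curves `M`: a family `σ t s` which is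
smooth in `(t, s)` and whose members `s ↦ σ t s` belong to `M`. -/
def SmoothFamily (M : Set (ℝ → M2)) (J : Set ℝ) (σ : ℝ → ℝ → M2) : Prop :=
  IsOpen J ∧ (∀ t ∈ J, σ t ∈ M) ∧
    ∀ i j, ContDiffOn ℝ ∞ (fun p : ℝ × ℝ => σ p.1 p.2 i j) (J ×ˢ Set.univ)

section Generic

/-! In this section `Vel σ t V` is to be read as: `V` represents the velocity at time `t` of the
family `σ`; `f` is a function on curves, and `Om g V₁ V₂` is a two-form. Three concrete choices
(hyperbolic, spherical, Euclidean) are made below. -/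

variable (M : Set (ℝ → M2)) (Vel : (ℝ → ℝ → M2) → ℝ → (ℝ → M2) → Prop)
  (f : (ℝ → M2) → ℝ) (Om : (ℝ → M2) → (ℝ → M2) → (ℝ → M2) → ℂ)

/-- `V` is a tangent vector of `M` at `g`: the velocity of a smooth curve in `M` through `g`. -/
def IsTangent (g V : ℝ → M2) : Prop :=
  ∃ (J : Set ℝ) (σ : ℝ → ℝ → M2), SmoothFamily M J σ ∧ (0 : ℝ) ∈ J ∧ σ 0 = g ∧ Vel σ 0 V

/-- `df(V) = Om(F, V)` for all tangent vectors `V` of `M` at `g`, where `df(V)` is the derivative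
of `f` along any smooth curve in `M` with velocity `V`. -/
def HamiltonEq (g F : ℝ → M2) : Prop :=
  ∀ (J : Set ℝ) (σ : ℝ → ℝ → M2) (V : ℝ → M2),
    SmoothFamily M J σ → (0 : ℝ) ∈ J → σ 0 = g → Vel σ 0 V →
      HasDerivAt (fun t : ℝ => ((f (σ t) : ℝ) : ℂ)) (Om g F V) 0

/-- `F` is the value at `g` of a Hamiltonian vector field of `f` on `M`. -/
def IsHamiltonianVector (g F : ℝ → M2) : Prop :=
  IsTangent M Vel g F ∧ HamiltonEq M Vel f Om g F

/-- `t ↦ σ t`, `t ∈ J`, is an integral curve in `M` of the Hamiltonian vector field of `f`. -/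
def IsHamiltonianFlow (J : Set ℝ) (σ : ℝ → ℝ → M2) : Prop :=
  SmoothFamily M J σ ∧
    ∀ t ∈ J, ∃ F : ℝ → M2, IsHamiltonianVector M Vel f Om (σ t) F ∧ Vel σ t F

end Generic

/-! ## Hyperbolic Darboux curves, in `SL₂(ℂ)` -/

/-- `Λ = g⁻¹ dg/ds`. -/
def tanH (g : ℝ → M2) (s : ℝ) : M2 := (g s)⁻¹ * dd g s

/-- Frame-periodic horizontal Darboux curves in `SL₂(ℂ)` anchored at `g(0) = I`, whose frame `R`
has initial value in `N`. The tangent `Λ` is `L`-periodic, so the curve over `[0, L]` is recorded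
by its canonical continuation to `ℝ`. -/
def HypCurves (L : ℝ) (N : Set M2) : Set (ℝ → M2) :=
  {g | SmoothCurve g ∧ (∀ s, (g s).det = 1) ∧ g 0 = 1 ∧
    (∃ R : ℝ → M2, SmoothCurve R ∧ (∀ s, R s ∈ SU2) ∧ R 0 ∈ N ∧
      ∀ s, tanH g s = R s * B1 * (R s)ᴴ) ∧
    Function.Periodic (tanH g) L}

/-- The frame-periodic anchored horizontal Darboux curves: `R(0) = I`. -/
def HorizPDh (L : ℝ) : Set (ℝ → M2) := HypCurves L {1}

/-- The same with a free initial frame: `g(0) = I`, but `R(0) ∈ SU₂` is arbitrary. -/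
def HorizPDhFree (L : ℝ) : Set (ℝ → M2) := HypCurves L SU2

/-- A variation `σ` of horizontal curves is represented by the curve of Hermitian matrices `V`
with `V(0) = 0` whose covariant derivative `dV/ds` is the variation `∂Λ/∂t`. -/
def HypVel (σ : ℝ → ℝ → M2) (t : ℝ) (V : ℝ → M2) : Prop :=
  V 0 = 0 ∧ ∀ s, HasDD V (dd (fun τ => tanH (σ τ) s) t) s

/-- The covariant derivative of `g V` along a horizontal curve `g` is `g (dV/ds)`; the curvature
of the projected curve is the norm of the covariant derivative of its tangent `g Λ`. -/
def curvatureH (g : ℝ → M2) (s : ℝ) : ℝ :=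
  √(trH (dd (tanH g) s) (dd (tanH g) s)).re

/-- `f = ½ ∫₀ᴸ κ² ds`. -/
def energyH (L : ℝ) (g : ℝ → M2) : ℝ := 1 / 2 * ∫ s in (0 : ℝ)..L, curvatureH g s ^ 2

/-- `ω(V₁, V₂) = (1/i) ∫₀ᴸ ⟨Λ, [dV₁/ds, dV₂/ds]⟩ ds`. -/
def omegaH (L : ℝ) (g V₁ V₂ : ℝ → M2) : ℂ :=
  1 / Complex.I * ∫ s in (0 : ℝ)..L, trH (tanH g s) (br (dd V₁ s) (dd V₂ s))

/-- `F(s) = i ∫₀ˢ [Λ'', Λ] dx`. -/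
def fieldH (g : ℝ → M2) (s : ℝ) : M2 :=
  Complex.I • intM (fun x => br (dd (dd (tanH g)) x) (tanH g x)) s

/-! ## Spherical Darboux curves, in `SU₂` -/

/-- `Λ = X* dX/ds`. -/
def tanS (X : ℝ → M2) (s : ℝ) : M2 := (X s)ᴴ * dd X s

/-- Frame-periodic horizontal Darboux curves in `SU₂ = S³` with `X(0) = I` and frame `R` having
initial value in `N`; the closed frame `R` is continued to `ℝ` as a smooth periodic curve. -/
def SphCurves (L : ℝ) (N : Set M2) : Set (ℝ → M2) :=
  {X | SmoothCurve X ∧ (∀ s, X s ∈ SU2) ∧ X 0 = 1 ∧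
    ∃ R : ℝ → M2, SmoothCurve R ∧ (∀ s, R s ∈ SU2) ∧ R 0 ∈ N ∧ Function.Periodic R L ∧
      ∀ s, tanS X s = R s * A1 * (R s)ᴴ}

/-- The frame-periodic anchored horizontal Darboux curves: `R(0) = I`. -/
def HorizPDs (L : ℝ) : Set (ℝ → M2) := SphCurves L {1}

/-- The same with a free initial frame. -/
def HorizPDsFree (L : ℝ) : Set (ℝ → M2) := SphCurves L SU2

/-- The velocity of `σ` is `∂σ/∂t = σ V`. -/
def SphVel (σ : ℝ → ℝ → M2) (t : ℝ) (V : ℝ → M2) : Prop :=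
  ∀ s, HasDD (fun τ => σ τ s) (σ t s * V s) t

/-- The covariant derivative of `X B` along `X` is `X (dB/ds + ½ [Λ, B])`. -/
def covS (X B : ℝ → M2) (s : ℝ) : M2 := dd B s + (1 / 2 : ℂ) • br (tanS X s) (B s)

/-- The curvature of `X`: the norm of the covariant derivative of its tangent `X Λ`. -/
def curvatureS (X : ℝ → M2) (s : ℝ) : ℝ :=
  √(trK (covS X (tanS X) s) (covS X (tanS X) s)).re

/-- `f = ½ ∫₀ᴸ κ² ds`. -/
def energyS (L : ℝ) (X : ℝ → M2) : ℝ := 1 / 2 * ∫ s in (0 : ℝ)..L, curvatureS X s ^ 2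

/-- `U = dV/ds - [Λ, V]`. -/
def defectS (X V : ℝ → M2) (s : ℝ) : M2 := dd V s - br (tanS X s) (V s)

/-- `ω(V₁, V₂) = -∫₀ᴸ ⟨Λ, [U₁, U₂]⟩ ds`. -/
def omegaS (L : ℝ) (X V₁ V₂ : ℝ → M2) : ℂ :=
  -∫ s in (0 : ℝ)..L, trK (tanS X s) (br (defectS X V₁ s) (defectS X V₂ s))

/-- `F` solves `dF/ds = [Λ, F] - [Λ, Λ'']`, `F(0) = 0`. -/
def SphField (X F : ℝ → M2) : Prop :=
  F 0 = 0 ∧ ∀ s, HasDD F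
    (br (tanS X s) (F s) - br (tanS X s) (dd (dd (tanS X)) s)) s

/-! ## Euclidean Darboux curves, in the space of Hermitian matrices of trace zero -/

/-- `Λ = dx/ds`. -/
def tanE (x : ℝ → M2) (s : ℝ) : M2 := dd x s

/-- Frame-periodic horizontal Darboux curves in `E³` with `x(0) = 0` and frame `R` having initial
value in `N`. -/
def EucCurves (L : ℝ) (N : Set M2) : Set (ℝ → M2) :=
  {x | SmoothCurve x ∧ x 0 = 0 ∧
    ∃ R : ℝ → M2, SmoothCurve R ∧ (∀ s, R s ∈ SU2) ∧ R 0 ∈ N ∧ Function.Periodic R L ∧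
      ∀ s, tanE x s = R s * B1 * (R s)ᴴ}

/-- The frame-periodic anchored horizontal Darboux curves: `R(0) = I`. -/
def HorizPDe (L : ℝ) : Set (ℝ → M2) := EucCurves L {1}

/-- The same with a free initial frame. -/
def HorizPDeFree (L : ℝ) : Set (ℝ → M2) := EucCurves L SU2

/-- The velocity of `σ` is `∂σ/∂t = V`. -/
def EucVel (σ : ℝ → ℝ → M2) (t : ℝ) (V : ℝ → M2) : Prop :=
  ∀ s, HasDD (fun τ => σ τ s) (V s) t

/-- The curvature `‖d²x/ds²‖`. -/
def curvatureE (x : ℝ → M2) (s : ℝ) : ℝ :=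
  √(trH (dd (tanE x) s) (dd (tanE x) s)).re

/-- `f = ½ ∫₀ᴸ κ² ds`. -/
def energyE (L : ℝ) (x : ℝ → M2) : ℝ := 1 / 2 * ∫ s in (0 : ℝ)..L, curvatureE x s ^ 2

/-- `ω(V₁, V₂) = (1/i) ∫₀ᴸ ⟨Λ, [dV₁/ds, dV₂/ds]⟩ ds`. -/
def omegaE (L : ℝ) (x V₁ V₂ : ℝ → M2) : ℂ :=
  1 / Complex.I * ∫ s in (0 : ℝ)..L, trH (tanE x s) (br (dd V₁ s) (dd V₂ s))

/-- `F(s) = i ∫₀ˢ [Λ'', Λ] dx`. -/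
def fieldE (x : ℝ → M2) (s : ℝ) : M2 :=
  Complex.I • intM (fun y => br (dd (dd (tanE x)) y) (tanE x y)) s

/-! ## Heisenberg's magnetic equation -/

/-- `∂Λ/∂t = c [∂²Λ/∂s², Λ]` for all `t ∈ J` and all `s`; `Λ t s` is the value at `(s, t)`.
The hyperbolic and Euclidean equation has `c = i`, the spherical one `c = 1`. -/
def Heisenberg (c : ℂ) (J : Set ℝ) (Λ : ℝ → ℝ → M2) : Prop :=
  ∀ t ∈ J, ∀ s, HasDD (fun τ => Λ τ s) (c • br (dd (dd (Λ t)) s) (Λ t s)) t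

end Darboux

end

open Darboux

/-! Everything is read off the tangent field T, equal to Λ in the hyperbolic and Euclidean cases and
to Λ/i in the spherical one. It is a Hermitian L-periodic curve with T² = 1/4, that is, a loop on a
round sphere. A variation of the curve gives v = ∂T/∂t, which is Hermitian, periodic and
anticommutes with T. The matrix curve V representing the velocity is recovered from v by a linear
initial value problem with V(0) = 0: dV/ds = v, or dV/ds - [Λ, V] = iv on the sphere. In these terms
all three energies are ½∫⟨T', T'⟩ and all three two-forms are -i∫⟨T, [u, v]⟩; `Model` records this,
and the main argument is made once for it.

Integration by parts gives df(v) = -∫⟨T'', v⟩ (`hasDerivAt_energy`). Since ⟨T, [[P, T], v]⟩ = -⟨P,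
v⟩ for v anticommuting with T (`trH_br_br`), the field u = i[T'', T] satisfies the Hamilton
equation. It is the only solution: if w pairs to zero with all variations vanishing at 0, testing
with v = iφwT, φ = 1 - cos(2πs/L), gives ∫φ‖w‖² = 0 (`IsVariation.eq_zero`). Only variations
vanishing at 0 are needed, so uniqueness holds even when the equation is tested on the curves with
R(0) = I alone.

This requires every v to come from a family of curves. A Cayley rotation S moves T in the direction
v and is the identity wherever v vanishes (`exists_rotation`); the curve with tangent field STS* is
then found by solving g' = gA with smooth dependence on the parameter (`exists_smooth_lift`), or by
a quadrature in the Euclidean case. With R(0) = I the value T(0) is fixed, whence the tangency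
condition u(0) = 0.

For flows, V and v determine each other, so having the Hamiltonian velocity means ∂T/∂t = i[T'', T].
The literal flow ∂g/∂t = gF is treated apart, through equality of mixed partials and the Hermitian
symmetry of the terms (`heisenberg_of_literal_flow`). -/

namespace Darboux

/-! ### Partial derivatives and integrals depending on a parameter. -/

section Calculus

variable {E : Type*} [NormedAddCommGroup E] [NormedSpace ℝ E]

/-- The partial derivative in the first variable. -/
noncomputable def pd₁ (f : ℝ × ℝ → E) (p : ℝ × ℝ) : E := fderiv ℝ f p (1, 0)

/-- The partial derivative in the second variable. -/
noncomputable def pd₂ (f : ℝ × ℝ → E) (p : ℝ × ℝ) : E := fderiv ℝ f p (0, 1)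

theorem hasDerivAt_pd₁ {f : ℝ × ℝ → E} {t s : ℝ} (hf : DifferentiableAt ℝ f (t, s)) :
    HasDerivAt (fun τ => f (τ, s)) (pd₁ f (t, s)) t :=
  hf.hasFDerivAt.comp_hasDerivAt t
    (HasDerivAt.prodMk (hasDerivAt_id t) (hasDerivAt_const t s))

theorem hasDerivAt_pd₂ {f : ℝ × ℝ → E} {t s : ℝ} (hf : DifferentiableAt ℝ f (t, s)) :
    HasDerivAt (fun x => f (t, x)) (pd₂ f (t, s)) s :=
  hf.hasFDerivAt.comp_hasDerivAt s
    (HasDerivAt.prodMk (hasDerivAt_const s t) (hasDerivAt_id s))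

/-- Continuous partials assemble to a total derivative. This drives the inductions on regularity
below: partials expressed through objects already known to be of class Cⁿ raise the class by one. -/
theorem contDiff_succ_of_partials {n : ℕ} {f p q : ℝ × ℝ → E}
    (hp : ∀ t s, HasDerivAt (fun τ => f (τ, s)) (p (t, s)) t)
    (hq : ∀ t s, HasDerivAt (fun x => f (t, x)) (q (t, s)) s)
    (cp : ContDiff ℝ n p) (cq : ContDiff ℝ n q) : ContDiff ℝ (n + 1 : ℕ) f := by
  push_cast
  rw [contDiff_succ_iff_hasFDerivAt]
  let c : E →L[ℝ] ℝ →L[ℝ] E :=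
    ((ContinuousLinearMap.smulRightL ℝ ℝ E) (ContinuousLinearMap.id ℝ ℝ))
  have hc : ∀ (x : E) (a : ℝ), c x a = a • x := fun x a => rfl
  refine ⟨fun u => (c (p u)).coprod (c (q u)), ?_, fun u => ?_⟩
  · have : (fun u => (c (p u)).coprod (c (q u))) = fun u =>
        (c (p u)).comp (ContinuousLinearMap.fst ℝ ℝ ℝ)
          + (c (q u)).comp (ContinuousLinearMap.snd ℝ ℝ ℝ) := by
      funext u; ext <;> simp
    rw [this]
    exact ((c.contDiff.comp cp).clm_comp contDiff_const).add
      ((c.contDiff.comp cq).clm_comp contDiff_const)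
  · refine (hasStrictFDerivAt_uncurry_coprod (𝕜 := ℝ) (f := fun t s => f (t, s))
      (f₁ := fun t s => c (p (t, s))) (f₂ := fun t s => c (q (t, s)))
      (Filter.Eventually.of_forall fun v => ?_) (Filter.Eventually.of_forall fun v => ?_)
      ?_ ?_).hasFDerivAt
    · rw [hasFDerivAt_iff_hasDerivAt]
      have := hp v.1 v.2
      simpa [hc, Function.HasUncurry.uncurry] using this
    · rw [hasFDerivAt_iff_hasDerivAt]
      have := hq v.1 v.2
      simpa [hc, Function.HasUncurry.uncurry] using this
    · exact (c.continuous.comp cp.continuous).continuousAt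
    · exact (c.continuous.comp cq.continuous).continuousAt

theorem ContDiff.pd₁ {n m : WithTop ℕ∞} {f : ℝ × ℝ → E} (hf : ContDiff ℝ n f) (hm : m + 1 ≤ n) :
    ContDiff ℝ m (pd₁ f) :=
  (hf.fderiv_right hm).clm_apply contDiff_const

/-- The difference quotient in the first variable, extended continuously to the diagonal. -/
noncomputable def diffQuot (f : ℝ × ℝ → E) (τ t x : ℝ) : E :=
  ∫ θ in (0 : ℝ)..1, pd₁ f (t + θ * (τ - t), x)

/-- The difference quotient at t is φ itself. Differentiation in a parameter thus reduces to
continuity of a Hadamard quotient. -/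
theorem hasDerivAt_smul_of_continuousAt {φ : ℝ → E} {t : ℝ} (hφ : ContinuousAt φ t) :
    HasDerivAt (fun τ => (τ - t) • φ τ) (φ t) t := by
  rw [hasDerivAt_iff_tendsto_slope]
  refine (hφ.tendsto.mono_left nhdsWithin_le_nhds).congr' ?_
  filter_upwards [self_mem_nhdsWithin] with τ hτ
  have : τ - t ≠ 0 := sub_ne_zero.2 hτ
  simp [slope_def_module, smul_smul, inv_mul_cancel₀ this]

variable [CompleteSpace E]

omit [CompleteSpace E] in
theorem continuous_diffQuot {f : ℝ × ℝ → E} (hf : ContDiff ℝ 1 f) :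
    Continuous fun p : ℝ × ℝ × ℝ => diffQuot f p.1 p.2.1 p.2.2 := by
  have h : Continuous (pd₁ f) := (ContDiff.pd₁ (m := 0) hf (by simp)).continuous
  unfold diffQuot
  apply intervalIntegral.continuous_parametric_intervalIntegral_of_continuous'
  simp only [Function.uncurry_def]
  fun_prop

theorem diffQuot_self (f : ℝ × ℝ → E) (t x : ℝ) : diffQuot f t t x = pd₁ f (t, x) := by
  simp [diffQuot]

theorem sub_eq_smul_diffQuot {f : ℝ × ℝ → E} (hf : ContDiff ℝ 1 f) (τ t x : ℝ) :
    f (τ, x) - f (t, x) = (τ - t) • diffQuot f τ t x := by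
  have h : Continuous (pd₁ f) := (ContDiff.pd₁ (m := 0) hf (by simp)).continuous
  have hd : ∀ θ ∈ Set.uIcc (0 : ℝ) 1, HasDerivAt (fun θ : ℝ => f (t + θ * (τ - t), x))
      ((τ - t) • pd₁ f (t + θ * (τ - t), x)) θ := by
    intro θ _
    have h1 : HasDerivAt (fun θ : ℝ => t + θ * (τ - t)) (τ - t) θ := by
      simpa using ((hasDerivAt_id θ).mul_const (τ - t)).const_add t
    exact (hasDerivAt_pd₁ (hf.differentiable (by simp) _)).scomp θ h1
  have := intervalIntegral.integral_eq_sub_of_hasDerivAt hd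
    (Continuous.intervalIntegrable (by fun_prop) _ _)
  rw [intervalIntegral.integral_smul] at this
  rw [diffQuot, this]
  simp

theorem hasDerivAt_integral_param {f : ℝ × ℝ → E} (hf : ContDiff ℝ 1 f) (t a b : ℝ) :
    HasDerivAt (fun τ => ∫ x in a..b, f (τ, x)) (∫ x in a..b, pd₁ f (t, x)) t := by
  have hc := hf.continuous
  have hq := continuous_diffQuot hf
  have h1 : ∀ τ, ∫ x in a..b, f (τ, x) =
      (∫ x in a..b, f (t, x)) + (τ - t) • ∫ x in a..b, diffQuot f τ t x := by
    intro τ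
    have h0 : Continuous fun x => f (t, x) := by fun_prop
    have hb : Continuous fun x => (τ - t) • diffQuot f τ t x :=
      (hq.comp (f := fun x => (τ, t, x)) (by fun_prop)).const_smul _
    rw [← intervalIntegral.integral_smul,
      ← intervalIntegral.integral_add (h0.intervalIntegrable _ _) (hb.intervalIntegrable _ _)]
    refine intervalIntegral.integral_congr fun x _ => ?_
    simp only [← sub_eq_smul_diffQuot hf]
    abel
  have h2 : Continuous fun τ => ∫ x in a..b, diffQuot f τ t x := by
    apply intervalIntegral.continuous_parametric_intervalIntegral_of_continuous'
    exact hq.comp (f := fun p : ℝ × ℝ => (p.1, t, p.2)) (by fun_prop)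
  have h3 := (hasDerivAt_smul_of_continuousAt h2.continuousAt (t := t)).const_add
    (∫ x in a..b, f (t, x))
  simp only [diffQuot_self] at h3
  exact h3.congr_of_eventuallyEq (Filter.Eventually.of_forall h1)

theorem hasDerivAt_primitive {f : ℝ → E} (hf : Continuous f) (a s : ℝ) :
    HasDerivAt (fun y => ∫ x in a..y, f x) (f s) s :=
  intervalIntegral.integral_hasDerivAt_right (hf.intervalIntegrable _ _)
    hf.aestronglyMeasurable.stronglyMeasurableAtFilter hf.continuousAt

/-- The t-derivative is again a primitive, of `pd₁ f`, and the s-derivative is f; hence the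
quantification over f inside the induction. -/
theorem contDiff_nat_parametric_primitive (n : ℕ) : ∀ {f : ℝ × ℝ → E}, ContDiff ℝ n f →
    ContDiff ℝ n fun p : ℝ × ℝ => ∫ x in (0 : ℝ)..p.2, f (p.1, x) := by
  induction n with
  | zero =>
    intro f hf
    have := hf.continuous
    refine contDiff_zero.2
      (intervalIntegral.continuous_parametric_primitive_of_continuous (f := fun t x => f (t, x)) ?_)
    exact this
  | succ n ih =>
    intro f hf
    have h1 : ContDiff ℝ 1 f := hf.of_le (by push_cast; simp)
    refine contDiff_succ_of_partials
      (p := fun p => ∫ x in (0 : ℝ)..p.2, pd₁ f (p.1, x)) (q := f)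
      (fun t s => hasDerivAt_integral_param h1 t 0 s)
      (fun t s => hasDerivAt_primitive
        (hf.continuous.comp (continuous_const.prodMk continuous_id)) 0 s)
      (ih (ContDiff.pd₁ hf (by simp))) (hf.of_le (by simp))

theorem contDiff_parametric_primitive {f : ℝ × ℝ → E} (hf : ContDiff ℝ ∞ f) :
    ContDiff ℝ ∞ fun p : ℝ × ℝ => ∫ x in (0 : ℝ)..p.2, f (p.1, x) :=
  contDiff_infty.2 fun n => contDiff_nat_parametric_primitive n (contDiff_infty.1 hf n)

end Calculus

/-! ## Linear differential equations with parameters -/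

section Dyson

variable {𝔸 : Type*} [NormedRing 𝔸] [NormedAlgebra ℝ 𝔸]

/-- The terms of the Dyson series for `∂G/∂s = G A`. -/
noncomputable def dyson (A : ℝ × ℝ → 𝔸) : ℕ → ℝ × ℝ → 𝔸
  | 0 => 1
  | n + 1 => fun p => ∫ x in (0 : ℝ)..p.2, dyson A n (p.1, x) * A (p.1, x)

theorem continuous_dyson {A : ℝ × ℝ → 𝔸} (hA : Continuous A) (n : ℕ) :
    Continuous (dyson A n) := by
  induction n with
  | zero => exact continuous_const
  | succ n ih =>
    refine intervalIntegral.continuous_parametric_primitive_of_continuous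
      (f := fun t x => dyson A n (t, x) * A (t, x)) ?_
    exact ih.mul hA

/-- Each iterated integral contributes a factor C|s|/(n + 1), so the Dyson series is dominated by an
exponential series. -/
theorem norm_dyson_le {A : ℝ × ℝ → 𝔸} {C T : ℝ} (t : ℝ)
    (hC : ∀ s, |s| ≤ T → ‖A (t, s)‖ ≤ C) (n : ℕ) :
    ∀ s, |s| ≤ T → ‖dyson A n (t, s)‖ ≤ ‖(1 : 𝔸)‖ * (C ^ n * |s| ^ n / n.factorial) := by
  induction n with
  | zero => intro s _; simp [dyson]
  | succ n ih =>
    intro s hs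
    have key : ∀ x ∈ Set.uIoc 0 s, ‖dyson A n (t, x) * A (t, x)‖ ≤
        ‖(1 : 𝔸)‖ * C ^ (n + 1) / n.factorial * |x - 0| ^ n := by
      intro x hx
      have hx' : |x| ≤ |s| := by
        rcases Set.mem_uIoc.1 hx with h | h
        · rw [abs_of_pos h.1, abs_of_pos (h.1.trans_le h.2)]; exact h.2
        · rw [abs_of_nonpos h.2, abs_of_neg (h.1.trans_le h.2)]; linarith [h.1]
      have h0 : 0 ≤ C := (norm_nonneg _).trans (hC x (hx'.trans hs))
      calc _ ≤ ‖dyson A n (t, x)‖ * ‖A (t, x)‖ := norm_mul_le _ _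
        _ ≤ (‖(1 : 𝔸)‖ * (C ^ n * |x| ^ n / n.factorial)) * C := by
          gcongr
          · exact ih x (hx'.trans hs)
          · exact hC x (hx'.trans hs)
        _ = _ := by rw [sub_zero]; ring
    have h1 := intervalIntegral.norm_integral_le_abs_of_norm_le (μ := MeasureTheory.volume)
      (f := fun x => dyson A n (t, x) * A (t, x)) (a := 0) (b := s)
      (g := fun x => ‖(1 : 𝔸)‖ * C ^ (n + 1) / n.factorial * |x - 0| ^ n)
      ((MeasureTheory.ae_restrict_iff' measurableSet_uIoc).2 (Filter.Eventually.of_forall key))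
      (Continuous.intervalIntegrable (by fun_prop) _ _)
    refine h1.trans (le_of_eq ?_)
    rw [intervalIntegral.abs_intervalIntegral_eq, MeasureTheory.integral_const_mul,
      integral_pow_abs_sub_uIoc]
    have h0 : 0 ≤ C := (norm_nonneg _).trans (hC s hs)
    rw [abs_of_nonneg (by positivity), Nat.factorial_succ]
    push_cast
    field_simp
    simp

/-- The solution of `∂G/∂s = G A`, `G(t, 0) = 1`. -/
noncomputable def propagator (A : ℝ × ℝ → 𝔸) (p : ℝ × ℝ) : 𝔸 := ∑' n, dyson A n p

theorem propagator_zero (A : ℝ × ℝ → 𝔸) (t : ℝ) : propagator A (t, 0) = 1 := by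
  rw [propagator, tsum_eq_single 0]
  · rfl
  · intro n hn
    obtain ⟨m, rfl⟩ := Nat.exists_eq_succ_of_ne_zero hn
    simp [dyson]

variable [CompleteSpace 𝔸]

omit [CompleteSpace 𝔸] in
theorem exists_dyson_bound {A : ℝ × ℝ → 𝔸} (hA : Continuous A) (T : ℝ) :
    ∃ u : ℕ → ℝ, Summable u ∧
      ∀ n t s, |t| ≤ T → |s| ≤ T →
        ‖dyson A n (t, s)‖ ≤ u n ∧ ‖dyson A n (t, s) * A (t, s)‖ ≤ u n := by
  obtain ⟨C, hC⟩ := ((isCompact_Icc (a := -T) (b := T)).prod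
    (isCompact_Icc (a := -T) (b := T))).exists_bound_of_continuousOn hA.continuousOn
  have hC' : ∀ t s, |t| ≤ T → |s| ≤ T → ‖A (t, s)‖ ≤ C := fun t s ht hs =>
    hC (t, s) ⟨abs_le.1 ht, abs_le.1 hs⟩
  -- The factor 1 + C lets one majorant control both the series and its product with A.
  refine ⟨fun n => ‖(1 : 𝔸)‖ * ((C * T) ^ n / n.factorial) * (1 + C),
    ((Real.summable_pow_div_factorial (C * T)).mul_left _).mul_right _, fun n t s ht hs => ?_⟩
  have h0 : 0 ≤ C := (norm_nonneg _).trans (hC' t s ht hs)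
  have hT : 0 ≤ T := (abs_nonneg _).trans hs
  have h1 : ‖dyson A n (t, s)‖ ≤ ‖(1 : 𝔸)‖ * ((C * T) ^ n / n.factorial) := by
    refine (norm_dyson_le t (fun s hs => hC' t s ht hs) n s hs).trans ?_
    rw [mul_pow]
    gcongr
  have h2 : 0 ≤ ‖(1 : 𝔸)‖ * ((C * T) ^ n / n.factorial) := by positivity
  constructor
  · nlinarith
  · calc _ ≤ ‖dyson A n (t, s)‖ * ‖A (t, s)‖ := norm_mul_le _ _
      _ ≤ ‖(1 : 𝔸)‖ * ((C * T) ^ n / n.factorial) * C :=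
        mul_le_mul h1 (hC' t s ht hs) (norm_nonneg _) h2
      _ ≤ _ := by nlinarith

theorem continuous_propagator {A : ℝ × ℝ → 𝔸} (hA : Continuous A) :
    Continuous (propagator A) := by
  rw [continuous_iff_continuousAt]
  rintro ⟨t, s⟩
  obtain ⟨u, hu, hb⟩ := exists_dyson_bound hA (max (|t| + 1) (|s| + 1))
  have hc : ContinuousOn (propagator A) {p : ℝ × ℝ | |p.1| < |t| + 1 ∧ |p.2| < |s| + 1} :=
    continuousOn_tsum (fun n => (continuous_dyson hA n).continuousOn) hu
      fun n p hp => (hb n p.1 p.2 (hp.1.le.trans (le_max_left _ _))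
        (hp.2.le.trans (le_max_right _ _))).1
  refine hc.continuousAt (IsOpen.mem_nhds ?_ ⟨by simp, by simp⟩)
  exact (isOpen_lt continuous_fst.abs continuous_const).inter
    (isOpen_lt continuous_snd.abs continuous_const)

/-- Termwise integration, by dominated convergence, shifts the Dyson series by one index. -/
theorem propagator_eq {A : ℝ × ℝ → 𝔸} (hA : Continuous A) (t s : ℝ) :
    propagator A (t, s) = 1 + ∫ x in (0 : ℝ)..s, propagator A (t, x) * A (t, x) := by
  obtain ⟨u, hu, hb⟩ := exists_dyson_bound hA (max |t| |s|)
  have hsum : ∀ x, |x| ≤ max |t| |s| → Summable fun n => dyson A n (t, x) := fun x hx =>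
    Summable.of_norm_bounded hu fun n => (hb n t x (le_max_left _ _) hx).1
  have hx' : ∀ x ∈ Set.uIoc 0 s, |x| ≤ max |t| |s| := by
    intro x hx
    refine le_max_of_le_right ?_
    rcases Set.mem_uIoc.1 hx with h | h
    · rw [abs_of_pos h.1, abs_of_pos (h.1.trans_le h.2)]; exact h.2
    · rw [abs_of_nonpos h.2, abs_of_neg (h.1.trans_le h.2)]; linarith [h.1]
  have h1 : HasSum (fun n => ∫ x in (0 : ℝ)..s, dyson A n (t, x) * A (t, x))
      (∫ x in (0 : ℝ)..s, propagator A (t, x) * A (t, x)) := by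
    refine intervalIntegral.hasSum_integral_of_dominated_convergence (fun n _ => u n)
      (fun n => ?_) (fun n => ?_) ?_ ?_ ?_
    · have hc : Continuous fun x : ℝ => dyson A n (t, x) * A (t, x) := by
        have := continuous_dyson hA n
        fun_prop
      exact hc.aestronglyMeasurable
    · exact Filter.Eventually.of_forall fun x hx => (hb n t x (le_max_left _ _) (hx' x hx)).2
    · exact Filter.Eventually.of_forall fun x _ => hu
    · exact intervalIntegrable_const
    · exact Filter.Eventually.of_forall fun x hx => (hsum x (hx' x hx)).hasSum.mul_right _
  have h2 := (hsum s (le_max_right _ _)).tsum_eq_zero_add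
  rw [propagator, h2, ← h1.tsum_eq]
  rfl

theorem hasDerivAt_propagator {A : ℝ × ℝ → 𝔸} (hA : Continuous A) (t s : ℝ) :
    HasDerivAt (fun x => propagator A (t, x)) (propagator A (t, s) * A (t, s)) s := by
  have hc : Continuous fun x => propagator A (t, x) * A (t, x) := by
    have := continuous_propagator hA
    fun_prop
  exact ((hasDerivAt_primitive hc 0 s).const_add 1).congr_of_eventuallyEq
    (Filter.Eventually.of_forall (propagator_eq hA t))

/-! ### Smooth dependence of solutions of G' = GA on the parameter. -/

section Smooth

variable {A G : ℝ × ℝ → 𝔸}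

theorem hasDerivAt_ringInverse {g : ℝ → 𝔸} {g' : 𝔸} {s : ℝ} (hg : HasDerivAt g g' s)
    (hu : IsUnit (g s)) :
    HasDerivAt (fun x => Ring.inverse (g x))
      (-(Ring.inverse (g s) * g' * Ring.inverse (g s))) s := by
  obtain ⟨u, hu⟩ := hu
  have h := hasFDerivAt_ringInverse (𝕜 := ℝ) u
  rw [hu] at h
  rw [← hu, Ring.inverse_unit]
  exact h.comp_hasDerivAt s hg

omit [NormedAlgebra ℝ 𝔸] in
theorem continuous_ringInverse (hG : Continuous G) (hu : ∀ p, IsUnit (G p)) :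
    Continuous fun p => Ring.inverse (G p) := by
  rw [continuous_iff_continuousAt]
  intro p
  obtain ⟨u, h⟩ := hu p
  exact ContinuousAt.comp (h ▸ NormedRing.inverse_continuousAt u) hG.continuousAt

/-- Duhamel's formula: the s-derivative of G(τ, s)G(t, s)⁻¹ sees only the difference of the
coefficients. -/
theorem mul_inverse_sub_one (hA : Continuous A) (hG : Continuous G)
    (hd : ∀ t s, HasDerivAt (fun x => G (t, x)) (G (t, s) * A (t, s)) s)
    (h0 : ∀ t, G (t, 0) = 1) (hu : ∀ p, IsUnit (G p)) (τ t s : ℝ) :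
    G (τ, s) * Ring.inverse (G (t, s)) - 1 = ∫ x in (0 : ℝ)..s,
      G (τ, x) * (A (τ, x) - A (t, x)) * Ring.inverse (G (t, x)) := by
  have hi : Continuous fun x => Ring.inverse (G (t, x)) :=
    (continuous_ringInverse hG hu).comp (by fun_prop)
  rw [intervalIntegral.integral_eq_sub_of_hasDerivAt
    (f := fun x => G (τ, x) * Ring.inverse (G (t, x)))]
  · rw [h0, h0, Ring.inverse_one, mul_one]
  · intro x _
    refine ((hd τ x).mul (hasDerivAt_ringInverse (hd t x) (hu _))).congr_deriv ?_
    have := Ring.inverse_mul_cancel _ (hu (t, x))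
    rw [show Ring.inverse (G (t, x)) * (G (t, x) * A (t, x)) = A (t, x) by
      rw [← mul_assoc, this, one_mul]]
    noncomm_ring
  · exact Continuous.intervalIntegrable (by fun_prop) _ _

/-- Duhamel's formula with A(τ, x) - A(t, x) = (τ - t)·`diffQuot`. The result involves G but none of
its t-derivatives, so continuity of G is enough to start a bootstrap. -/
theorem hasDerivAt_param (hA : ContDiff ℝ 1 A) (hG : Continuous G)
    (hd : ∀ t s, HasDerivAt (fun x => G (t, x)) (G (t, s) * A (t, s)) s)
    (h0 : ∀ t, G (t, 0) = 1) (hu : ∀ p, IsUnit (G p)) (t s : ℝ) :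
    HasDerivAt (fun τ => G (τ, s))
      ((∫ x in (0 : ℝ)..s, G (t, x) * pd₁ A (t, x) * Ring.inverse (G (t, x))) * G (t, s)) t := by
  have hi : Continuous fun x => Ring.inverse (G (t, x)) :=
    (continuous_ringInverse hG hu).comp (by fun_prop)
  have hq := continuous_diffQuot hA
  have h2 : Continuous fun τ => ∫ x in (0 : ℝ)..s,
      G (τ, x) * diffQuot A τ t x * Ring.inverse (G (t, x)) := by
    apply intervalIntegral.continuous_parametric_intervalIntegral_of_continuous'
    have : Continuous fun p : ℝ × ℝ => diffQuot A p.1 t p.2 :=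
      hq.comp (f := fun p : ℝ × ℝ => (p.1, t, p.2)) (by fun_prop)
    have hi2 : Continuous fun p : ℝ × ℝ => Ring.inverse (G (t, p.2)) := hi.comp continuous_snd
    simp only [Function.uncurry_def]
    fun_prop
  have h3 := ((hasDerivAt_smul_of_continuousAt h2.continuousAt (t := t)).add_const 1).mul_const
    (G (t, s))
  simp only [diffQuot_self] at h3
  refine h3.congr_of_eventuallyEq (Filter.Eventually.of_forall fun τ => ?_)
  have h4 := mul_inverse_sub_one hA.continuous hG hd h0 hu τ t s
  have h5 : G (τ, s) = (G (τ, s) * Ring.inverse (G (t, s)) - 1 + 1) * G (t, s) := by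
    rw [sub_add_cancel, mul_assoc, Ring.inverse_mul_cancel _ (hu _), mul_one]
  simp only
  rw [h5, h4, ← intervalIntegral.integral_smul]
  simp only [sub_eq_smul_diffQuot hA, mul_smul_comm, smul_mul_assoc]

/-- Bootstrap: both partials of G are built from G, G⁻¹, A and `pd₁ A` by products and primitives,
so G gains one derivative at each step. -/
theorem contDiff_of_linear_ode (hA : ContDiff ℝ ∞ A) (hG : Continuous G)
    (hd : ∀ t s, HasDerivAt (fun x => G (t, x)) (G (t, s) * A (t, s)) s)
    (h0 : ∀ t, G (t, 0) = 1) (hu : ∀ p, IsUnit (G p)) : ContDiff ℝ ∞ G := by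
  refine contDiff_infty.2 fun n => ?_
  induction n with
  | zero => exact contDiff_zero.2 hG
  | succ n ih =>
    have hA' := contDiff_infty.1 hA
    have hi : ContDiff ℝ n fun p => Ring.inverse (G p) := by
      rw [contDiff_iff_contDiffAt]
      intro p
      obtain ⟨u, h⟩ := hu p
      exact ContDiffAt.comp p (h ▸ contDiffAt_ringInverse ℝ u) ih.contDiffAt
    have hp : ContDiff ℝ n (pd₁ A) := ContDiff.pd₁ (hA' (n + 1)) (by simp)
    exact contDiff_succ_of_partials (hasDerivAt_param (hA' 1) hG hd h0 hu) hd
      ((contDiff_nat_parametric_primitive n ((ih.mul hp).mul hi)).mul ih) (ih.mul (hA' n))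

end Smooth

end Dyson

/-! ### Entrywise definitions translated into normed-space calculus; algebra of 2 × 2 matrices. -/

section MatrixCalculus

open scoped Matrix.Norms.Operator

/-- The coordinates of a matrix, as a continuous linear equivalence. -/
noncomputable def entriesL : M2 ≃L[ℝ] (Fin 2 → Fin 2 → ℂ) :=
  (Matrix.ofLinearEquiv (R := ℝ) (α := ℂ) (m := Fin 2) (n := Fin 2)).symm.toContinuousLinearEquiv

theorem smoothCurve_iff {A : ℝ → M2} : SmoothCurve A ↔ ContDiff ℝ ∞ A := by
  rw [← entriesL.comp_contDiff_iff, contDiff_pi]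
  simp only [contDiff_pi]
  rfl

theorem contDiffOn_entries {A : ℝ × ℝ → M2} {U : Set (ℝ × ℝ)} :
    (∀ i j, ContDiffOn ℝ ∞ (fun p => A p i j) U) ↔ ContDiffOn ℝ ∞ A U := by
  rw [← entriesL.comp_contDiffOn_iff, contDiffOn_pi]
  simp only [contDiffOn_pi]
  rfl

theorem hasDD_iff {A : ℝ → M2} {D : M2} {s : ℝ} : HasDD A D s ↔ HasDerivAt A D s := by
  have h : HasDerivAt A D s ↔ HasDerivAt (fun x => entriesL (A x)) (entriesL D) s := by
    refine ⟨fun h => entriesL.toContinuousLinearMap.hasFDerivAt.comp_hasDerivAt s h, fun h => ?_⟩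
    have := entriesL.symm.toContinuousLinearMap.hasFDerivAt.comp_hasDerivAt s h
    exact (this.congr_deriv (entriesL.symm_apply_apply D)).congr_of_eventuallyEq
      (Filter.Eventually.of_forall fun x => (entriesL.symm_apply_apply (A x)).symm)
  rw [h, hasDerivAt_pi]
  simp only [hasDerivAt_pi]
  rfl

theorem HasDD.dd_eq {A : ℝ → M2} {D : M2} {s : ℝ} (h : HasDD A D s) : dd A s = D := by
  ext i j
  exact (h i j).deriv

theorem dd_eq_deriv {A : ℝ → M2} {s : ℝ} (h : DifferentiableAt ℝ A s) : dd A s = deriv A s :=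
  (hasDD_iff.2 h.hasDerivAt).dd_eq

theorem dd_eq_deriv_of_contDiff {A : ℝ → M2} (h : ContDiff ℝ ∞ A) : dd A = deriv A :=
  funext fun s => dd_eq_deriv (h.differentiable (by simp) s)

theorem contDiff_deriv {A : ℝ → M2}
    (h : ContDiff ℝ ∞ A) : ContDiff ℝ ∞ (deriv A) :=
  (contDiff_infty_iff_deriv.1 h).2

theorem intM_eq {A : ℝ → M2} (h : Continuous A) (s : ℝ) :
    intM A s = ∫ x in (0 : ℝ)..s, A x := by
  ext i j
  let e : M2 →L[ℝ] ℂ := ((ContinuousLinearMap.proj j).comp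
    (ContinuousLinearMap.proj (R := ℝ) (φ := fun _ : Fin 2 => Fin 2 → ℂ) i)).comp
      entriesL.toContinuousLinearMap
  exact e.intervalIntegral_comp_comm (h.intervalIntegrable (μ := MeasureTheory.volume) 0 s)

theorem HasDerivAt.conjTranspose {A : ℝ → M2} {D : M2} {s : ℝ} (h : HasDerivAt A D s) :
    HasDerivAt (fun x => (A x)ᴴ) Dᴴ s := by
  rw [← hasDD_iff] at h ⊢
  intro i j
  exact (h j i).star

theorem contDiff_conjTranspose {E : Type*} [NormedAddCommGroup E] [NormedSpace ℝ E]
    {A : E → M2} {n : WithTop ℕ∞} (h : ContDiff ℝ n A) : ContDiff ℝ n fun x => (A x)ᴴ := by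
  let c : M2 →L[ℝ] M2 :=
    (Matrix.conjTransposeLinearEquiv (Fin 2) (Fin 2) ℝ ℂ).toLinearMap.toContinuousLinearMap
  exact c.contDiff.comp h

theorem contDiffOn_conjTranspose {E : Type*} [NormedAddCommGroup E] [NormedSpace ℝ E]
    {A : E → M2} {n : WithTop ℕ∞} {U : Set E} (h : ContDiffOn ℝ n A U) :
    ContDiffOn ℝ n (fun x => (A x)ᴴ) U := by
  let c : M2 →L[ℝ] M2 :=
    (Matrix.conjTransposeLinearEquiv (Fin 2) (Fin 2) ℝ ℂ).toLinearMap.toContinuousLinearMap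
  exact c.contDiff.comp_contDiffOn h

/-- For 2 × 2 matrices the adjugate is tr(A)·1 - A, an affine expression in A. On determinant one it
is the inverse, which makes g⁻¹ dg/ds smooth in all variables. -/
theorem contDiff_adjugate : ContDiff ℝ ∞ fun A : M2 => A.adjugate := by
  have h : ∀ A : M2, A.adjugate = (Matrix.trace A) • (1 : M2) - A := by
    intro A
    rw [Matrix.adjugate_fin_two]
    ext i j
    fin_cases i <;> fin_cases j <;> simp [Matrix.trace_fin_two]
  let c : M2 →L[ℝ] ℂ := (Matrix.traceLinearMap (Fin 2) ℝ ℂ).toContinuousLinearMap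
  simp only [h]
  exact (c.contDiff.smul contDiff_const).sub contDiff_id

theorem inv_eq_adjugate {A : M2} (h : A.det = 1) : A⁻¹ = A.adjugate := by
  rw [Matrix.inv_def, h]
  simp

/-! ## Families of two variables -/

section Partials

variable {E : Type*} [NormedAddCommGroup E] [NormedSpace ℝ E] {f : ℝ × ℝ → E} {J : Set ℝ}

theorem isOpen_strip (hJ : IsOpen J) : IsOpen (J ×ˢ (Set.univ : Set ℝ)) := hJ.prod isOpen_univ

theorem contDiffAt_strip {n : WithTop ℕ∞} (hJ : IsOpen J)
    (hf : ContDiffOn ℝ n f (J ×ˢ Set.univ)) {t : ℝ} (ht : t ∈ J) (s : ℝ) :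
    ContDiffAt ℝ n f (t, s) :=
  hf.contDiffAt ((isOpen_strip hJ).mem_nhds ⟨ht, trivial⟩)

theorem ContDiffOn.pd₁ (hJ : IsOpen J) (hf : ContDiffOn ℝ ∞ f (J ×ˢ Set.univ)) :
    ContDiffOn ℝ ∞ (pd₁ f) (J ×ˢ Set.univ) :=
  (hf.fderiv_of_isOpen (isOpen_strip hJ) (m := ∞) (by simp)).clm_apply contDiffOn_const

theorem ContDiffOn.pd₂ (hJ : IsOpen J) (hf : ContDiffOn ℝ ∞ f (J ×ˢ Set.univ)) :
    ContDiffOn ℝ ∞ (pd₂ f) (J ×ˢ Set.univ) :=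
  (hf.fderiv_of_isOpen (isOpen_strip hJ) (m := ∞) (by simp)).clm_apply contDiffOn_const

theorem hasDerivAt_fst (hJ : IsOpen J) (hf : ContDiffOn ℝ ∞ f (J ×ˢ Set.univ)) {t : ℝ}
    (ht : t ∈ J) (s : ℝ) : HasDerivAt (fun τ => f (τ, s)) (Darboux.pd₁ f (t, s)) t :=
  hasDerivAt_pd₁ ((contDiffAt_strip hJ hf ht s).differentiableAt (by simp))

theorem hasDerivAt_snd (hJ : IsOpen J) (hf : ContDiffOn ℝ ∞ f (J ×ˢ Set.univ)) {t : ℝ}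
    (ht : t ∈ J) (s : ℝ) : HasDerivAt (fun x => f (t, x)) (Darboux.pd₂ f (t, s)) s :=
  hasDerivAt_pd₂ ((contDiffAt_strip hJ hf ht s).differentiableAt (by simp))

theorem contDiff_slice (hf : ContDiffOn ℝ ∞ f (J ×ˢ Set.univ)) {t : ℝ} (ht : t ∈ J) :
    ContDiff ℝ ∞ fun s => f (t, s) := by
  rw [← contDiffOn_univ]
  exact hf.comp (contDiff_const.prodMk contDiff_id).contDiffOn fun s _ => ⟨ht, trivial⟩

theorem pd₁_pd₂ (hJ : IsOpen J) (hf : ContDiffOn ℝ ∞ f (J ×ˢ Set.univ)) {t : ℝ} (ht : t ∈ J)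
    (s : ℝ) : Darboux.pd₁ (Darboux.pd₂ f) (t, s) = Darboux.pd₂ (Darboux.pd₁ f) (t, s) := by
  have h := contDiffAt_strip hJ hf ht s
  have hd : DifferentiableAt ℝ (fderiv ℝ f) (t, s) :=
    (h.fderiv_right (m := 1) (by norm_cast)).differentiableAt (by simp)
  have hs : IsSymmSndFDerivAt ℝ f (t, s) :=
    h.isSymmSndFDerivAt (by simp; norm_cast)
  have key : ∀ v w : ℝ × ℝ, fderiv ℝ (fun q => fderiv ℝ f q w) (t, s) v =
      fderiv ℝ (fderiv ℝ f) (t, s) v w := by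
    intro v w
    rw [fderiv_clm_apply hd (differentiableAt_const w)]
    simp
  unfold Darboux.pd₁ Darboux.pd₂
  rw [key, key]
  exact hs _ _

/-- Version for integrands smooth only over the open set J of times: a compact ball around t inside
J supplies a constant dominating function. -/
theorem hasDerivAt_integral_of_contDiffOn (hJ : IsOpen J)
    (hf : ContDiffOn ℝ ∞ f (J ×ˢ Set.univ)) {t : ℝ} (ht : t ∈ J) (a b : ℝ) :
    HasDerivAt (fun τ => ∫ x in a..b, f (τ, x)) (∫ x in a..b, Darboux.pd₁ f (t, x)) t := by
  obtain ⟨ε, hε, hb⟩ := Metric.nhds_basis_closedBall.mem_iff.1 (hJ.mem_nhds ht)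
  have hp := ContDiffOn.pd₁ hJ hf
  obtain ⟨C, hC⟩ := ((isCompact_closedBall t ε).prod
    (isCompact_uIcc (a := a) (b := b))).exists_bound_of_continuousOn
      (hp.continuousOn.mono (Set.prod_mono hb (Set.subset_univ _)))
  have hc : ∀ τ ∈ J, Continuous fun x => f (τ, x) := fun τ hτ => (contDiff_slice hf hτ).continuous
  refine (intervalIntegral.hasDerivAt_integral_of_dominated_loc_of_deriv_le
    (s := Metric.closedBall t ε) (bound := fun _ => C) (F' := fun τ x => Darboux.pd₁ f (τ, x))
    (Metric.closedBall_mem_nhds t hε) ?_ ((hc t ht).intervalIntegrable _ _) ?_ ?_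
    intervalIntegrable_const ?_).2
  · filter_upwards [hJ.mem_nhds ht] with τ hτ
    exact (hc τ hτ).aestronglyMeasurable
  · exact (contDiff_slice hp ht).continuous.aestronglyMeasurable
  · exact Filter.Eventually.of_forall fun x hx τ hτ =>
      hC (τ, x) ⟨hτ, Set.uIoc_subset_uIcc hx⟩
  · exact Filter.Eventually.of_forall fun x _ τ hτ => hasDerivAt_fst hJ hf (hb hτ) x

end Partials

/-! ## The trace form and the bracket -/

theorem trH_smul_right (c : ℂ) (A B : M2) : trH A (c • B) = c * trH A B := by
  simp [trH]; ring

theorem trH_sub_right (A B C : M2) : trH A (B - C) = trH A B - trH A C := by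
  simp [trH, mul_sub]

theorem br_smul_left (c : ℂ) (A B : M2) : br (c • A) B = c • br A B := by
  simp [br, smul_sub]

theorem br_smul_right (c : ℂ) (A B : M2) : br A (c • B) = c • br A B := by
  simp [br, smul_sub]

theorem br_sub_left (A B C : M2) : br (A - B) C = br A C - br B C := by
  simp only [br]; noncomm_ring

theorem hasDerivAt_trH {A B : ℝ → M2} {A' B' : M2} {s : ℝ} (hA : HasDerivAt A A' s)
    (hB : HasDerivAt B B' s) :
    HasDerivAt (fun x => trH (A x) (B x)) (trH A' (B s) + trH (A s) B') s := by
  let c : M2 →L[ℝ] ℂ := (Matrix.traceLinearMap (Fin 2) ℝ ℂ).toContinuousLinearMap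
  have h := (c.hasFDerivAt.comp_hasDerivAt s (hA.mul hB)).const_mul (2 : ℂ)
  refine h.congr_deriv ?_
  change 2 * Matrix.trace (A' * B s + A s * B') = _
  rw [Matrix.trace_add, mul_add]
  rfl

theorem contDiffOn_trH {E : Type*} [NormedAddCommGroup E] [NormedSpace ℝ E]
    {A B : E → M2} {n : WithTop ℕ∞} {U : Set E} (hA : ContDiffOn ℝ n A U)
    (hB : ContDiffOn ℝ n B U) : ContDiffOn ℝ n (fun x => trH (A x) (B x)) U := by
  let c : M2 →L[ℝ] ℂ := (Matrix.traceLinearMap (Fin 2) ℝ ℂ).toContinuousLinearMap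
  exact contDiffOn_const.mul (c.contDiff.comp_contDiffOn (hA.mul hB))

theorem continuous_trH {A B : ℝ → M2} (hA : Continuous A) (hB : Continuous B) :
    Continuous fun x => trH (A x) (B x) := by
  unfold trH
  fun_prop

theorem contDiff_br {E : Type*} [NormedAddCommGroup E] [NormedSpace ℝ E]
    {A B : E → M2} {n : WithTop ℕ∞} (hA : ContDiff ℝ n A) (hB : ContDiff ℝ n B) :
    ContDiff ℝ n fun x => br (A x) (B x) :=
  (hB.mul hA).sub (hA.mul hB)

/-- Anticommutation gives ΛvΛ = -v/4, and cyclicity of the trace does the rest. This identity turns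
the first variation -∫⟨Λ'', v⟩ into the two-form evaluated on i[Λ'', Λ]. -/
theorem trH_br_br {Λ P v : M2} (hΛ : Λ * Λ = (1 / 4 : ℂ) • 1) (hv : v * Λ = -(Λ * v)) :
    trH Λ (br (br P Λ) v) = -trH P v := by
  have h1 : Λ * v * Λ = -((1 / 4 : ℂ) • v) := by
    rw [mul_assoc, hv, mul_neg, ← mul_assoc, hΛ, smul_mul_assoc, one_mul]
  have e : Λ * br (br P Λ) v =
      Λ * v * Λ * P - Λ * (v * P * Λ) - Λ * Λ * (P * v) + Λ * (P * (Λ * v)) := by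
    simp only [br]; noncomm_ring
  have t1 : (Λ * (v * P * Λ)).trace = (Λ * Λ * (v * P)).trace := by
    rw [Matrix.trace_mul_comm]
    rw [mul_assoc, Matrix.trace_mul_comm]
  have t2 : (Λ * (P * (Λ * v))).trace = (P * (Λ * v * Λ)).trace := by
    rw [Matrix.trace_mul_comm]
    simp only [mul_assoc]
  simp only [trH]
  rw [e, Matrix.trace_add, Matrix.trace_sub, Matrix.trace_sub, t1, t2, hΛ, h1]
  simp only [neg_mul, mul_neg, smul_mul_assoc, mul_smul_comm, one_mul, Matrix.trace_neg,
    Matrix.trace_smul, smul_eq_mul]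
  rw [Matrix.trace_mul_comm v P]
  ring

/-- Nondegeneracy of the two-form: up to scale, iwΛ is w turned by a right angle in the tangent
plane of the sphere at Λ. -/
theorem trH_br_test {Λ w : M2} (c : ℂ) (hΛ : Λ * Λ = (1 / 4 : ℂ) • 1)
    (hw : w * Λ = -(Λ * w)) : trH Λ (br w (c • (w * Λ))) = -c * (w * w).trace := by
  have h1 : Λ * w * Λ = -((1 / 4 : ℂ) • w) := by
    rw [mul_assoc, hw, mul_neg, ← mul_assoc, hΛ, smul_mul_assoc, one_mul]
  have e : Λ * br w (c • (w * Λ)) = c • (Λ * w * (Λ * w) - Λ * w * (w * Λ)) := by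
    simp only [br, mul_sub, smul_mul_assoc, mul_smul_comm, smul_sub]
    noncomm_ring
  have t1 : (Λ * w * (w * Λ)).trace = (Λ * Λ * (w * w)).trace := by
    rw [← mul_assoc, Matrix.trace_mul_comm]
    simp only [mul_assoc]
  simp only [trH]
  rw [e, Matrix.trace_smul, Matrix.trace_sub, t1, ← mul_assoc (Λ * w) Λ w, h1, hΛ]
  simp only [neg_mul, smul_mul_assoc, one_mul, Matrix.trace_neg, Matrix.trace_smul, smul_eq_mul]
  ring

theorem trace_mul_self_of_hermitian {w : M2} (h : wᴴ = w) :
    (w * w).trace = ((∑ i, ∑ j, ‖w i j‖ ^ 2 : ℝ) : ℂ) := by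
  have : w * w = w * wᴴ := by rw [h]
  rw [this]
  push_cast
  simp only [Matrix.trace, Matrix.diag_apply, Matrix.mul_apply, Matrix.conjTranspose_apply]
  simp [Complex.mul_conj']

theorem sum_norm_sq_pos {w : M2} (h : w ≠ 0) : 0 < ∑ i, ∑ j, ‖w i j‖ ^ 2 := by
  have h0 : ∀ i, 0 ≤ ∑ j, ‖w i j‖ ^ 2 := fun i => by positivity
  by_contra hn
  apply h
  have h1 : ∑ i, ∑ j, ‖w i j‖ ^ 2 = 0 :=
    le_antisymm (not_lt.1 hn) (Finset.sum_nonneg fun i _ => h0 i)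
  ext i j
  have h2 := (Finset.sum_eq_zero_iff_of_nonneg fun i _ => h0 i).1 h1 i (Finset.mem_univ i)
  have h3 := (Finset.sum_eq_zero_iff_of_nonneg fun j _ => by positivity).1 h2 j (Finset.mem_univ j)
  simpa using h3

/-! ## Frames -/

theorem SU2.mul_conjTranspose {R : M2} (h : R ∈ SU2) : R * Rᴴ = 1 :=
  (Matrix.mem_unitaryGroup_iff.1 (Matrix.mem_specialUnitaryGroup_iff.1 h).1)

theorem SU2.conjTranspose_mul {R : M2} (h : R ∈ SU2) : Rᴴ * R = 1 :=
  (Matrix.mem_unitaryGroup_iff'.1 (Matrix.mem_specialUnitaryGroup_iff.1 h).1)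

theorem SU2.det {R : M2} (h : R ∈ SU2) : R.det = 1 := (Matrix.mem_specialUnitaryGroup_iff.1 h).2

theorem mem_SU2 {R : M2} (h : R * Rᴴ = 1) (hd : R.det = 1) : R ∈ SU2 :=
  Matrix.mem_specialUnitaryGroup_iff.2 ⟨Matrix.mem_unitaryGroup_iff.2 h, hd⟩

theorem B1_conjTranspose : B1ᴴ = B1 := by
  ext i j
  fin_cases i <;> fin_cases j <;> simp [B1]

theorem B1_sq : B1 * B1 = (1 / 4 : ℂ) • 1 := by
  ext i j
  fin_cases i <;> fin_cases j <;> simp [B1, Matrix.mul_apply] <;> norm_num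

theorem B1_trace : B1.trace = 0 := by simp [B1, Matrix.trace_fin_two]

theorem A1_eq : A1 = Complex.I • B1 := by
  ext i j
  fin_cases i <;> fin_cases j <;> simp [A1, B1] <;> ring

theorem frame_conjTranspose (R : M2) : (R * B1 * Rᴴ)ᴴ = R * B1 * Rᴴ := by
  simp [Matrix.conjTranspose_mul, B1_conjTranspose, mul_assoc]

theorem frame_sq {R : M2} (h : R ∈ SU2) :
    R * B1 * Rᴴ * (R * B1 * Rᴴ) = (1 / 4 : ℂ) • 1 := by
  calc _ = R * B1 * (Rᴴ * R) * B1 * Rᴴ := by noncomm_ring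
    _ = R * (B1 * B1) * Rᴴ := by rw [SU2.conjTranspose_mul h]; noncomm_ring
    _ = _ := by rw [B1_sq]; simp [SU2.mul_conjTranspose h]

theorem frame_trace {R : M2} (h : R ∈ SU2) : (R * B1 * Rᴴ).trace = 0 := by
  rw [Matrix.trace_mul_comm, ← mul_assoc, SU2.conjTranspose_mul h, one_mul, B1_trace]

end MatrixCalculus

/-! ### Loops on the sphere and their variations. -/

section Variations

open scoped Matrix.Norms.Operator

/-- Smooth `L`-periodic curves on the unit sphere of Hermitian matrices of trace zero. -/
structure IsTangentField (L : ℝ) (Λ : ℝ → M2) : Prop where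
  smooth : ContDiff ℝ ∞ Λ
  periodic : Function.Periodic Λ L
  herm : ∀ s, (Λ s)ᴴ = Λ s
  sq : ∀ s, Λ s * Λ s = (1 / 4 : ℂ) • 1

/-- Smooth `L`-periodic vector fields along `Λ`, tangent to the sphere. -/
structure IsVariation (L : ℝ) (Λ v : ℝ → M2) : Prop where
  smooth : ContDiff ℝ ∞ v
  periodic : Function.Periodic v L
  herm : ∀ s, (v s)ᴴ = v s
  anti : ∀ s, v s * Λ s = -(Λ s * v s)

/-- The right-hand side `i [Λ'', Λ]` of Heisenberg's equation. -/
noncomputable def heisenbergField (Λ : ℝ → M2) (s : ℝ) : M2 :=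
  Complex.I • br (deriv (deriv Λ) s) (Λ s)

variable {L : ℝ} {Λ v w : ℝ → M2}

theorem periodic_deriv {f : ℝ → M2} (h : Function.Periodic f L) :
    Function.Periodic (deriv f) L := fun s =>
  (deriv_comp_add_const f L s).symm.trans (congrArg (fun k => deriv k s) (funext h))

theorem hermitian_deriv (hs : ContDiff ℝ ∞ Λ) (h : ∀ s, (Λ s)ᴴ = Λ s) (s : ℝ) :
    (deriv Λ s)ᴴ = deriv Λ s := by
  have hd := (hs.differentiable (by simp) s).hasDerivAt
  have h1 := HasDerivAt.conjTranspose hd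
  rw [funext h] at h1
  exact h1.unique hd

theorem conjTranspose_I_smul_br {A B : M2} (hA : Aᴴ = A) (hB : Bᴴ = B) :
    (Complex.I • br A B)ᴴ = Complex.I • br A B := by
  simp only [br, Matrix.conjTranspose_smul, Matrix.conjTranspose_sub, Matrix.conjTranspose_mul,
    hA, hB]
  simp only [RCLike.star_def, Complex.conj_I, neg_smul, smul_sub]
  abel

theorem IsTangentField.isVariation_heisenbergField (h : IsTangentField L Λ) :
    IsVariation L Λ (heisenbergField Λ) where
  smooth := (contDiff_br (contDiff_deriv (contDiff_deriv h.smooth)) h.smooth).const_smul _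
  periodic s := congrArg (Complex.I • ·)
    (congrArg₂ br (periodic_deriv (periodic_deriv h.periodic) s) (h.periodic s))
  herm s := conjTranspose_I_smul_br
    (hermitian_deriv (contDiff_deriv h.smooth) (hermitian_deriv h.smooth h.herm) s) (h.herm s)
  anti s := by
    have e := h.sq s
    set P := deriv (deriv Λ) s
    -- A bracket with Λ anticommutes with Λ because Λ² is scalar; no property of P is used.
    have : br P (Λ s) * Λ s + Λ s * br P (Λ s) = Λ s * Λ s * P - P * (Λ s * Λ s) := by
      simp only [br]; noncomm_ring
    rw [e] at this
    simp only [smul_mul_assoc, mul_smul_comm, one_mul, mul_one, sub_self] at this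
    simp only [heisenbergField, smul_mul_assoc, mul_smul_comm]
    rw [eq_neg_of_add_eq_zero_left this, smul_neg]

theorem IsVariation.sub (hv : IsVariation L Λ v) (hw : IsVariation L Λ w) :
    IsVariation L Λ (v - w) where
  smooth := hv.smooth.sub hw.smooth
  periodic s := by simp [hv.periodic s, hw.periodic s]
  herm s := by simp [hv.herm, hw.herm]
  anti s := by simp only [Pi.sub_apply, sub_mul, mul_sub, hv.anti, hw.anti]; abel

theorem IsVariation.rotate (h : IsTangentField L Λ) (hw : IsVariation L Λ w) {φ : ℝ → ℝ}
    (hφ : ContDiff ℝ ∞ φ) (hp : Function.Periodic φ L) :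
    IsVariation L Λ fun s => ((φ s : ℂ) * Complex.I) • (w s * Λ s) where
  smooth := by
    have : ContDiff ℝ ∞ fun s => ((φ s : ℂ) * Complex.I) :=
      (Complex.ofRealCLM.contDiff.comp hφ).mul contDiff_const
    exact this.smul (hw.smooth.mul h.smooth)
  periodic s := by simp only [hp s, hw.periodic s, h.periodic s]
  herm s := by
    rw [Matrix.conjTranspose_smul, Matrix.conjTranspose_mul, hw.herm, h.herm, hw.anti]
    simp
  anti s := by
    simp only [smul_mul_assoc, mul_smul_comm, ← mul_assoc (Λ s), ← smul_neg]
    rw [← neg_mul, ← hw.anti]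

/-- The fundamental lemma of the calculus of variations on the sphere. -/
theorem IsVariation.eq_zero (hL : 0 < L) (h : IsTangentField L Λ) (hw : IsVariation L Λ w)
    (h0 : ∀ v, IsVariation L Λ v → v 0 = 0 → ∫ s in (0 : ℝ)..L, trH (Λ s) (br (w s) (v s)) = 0) :
    w = 0 := by
  -- A smooth periodic weight that vanishes at 0, so that the test field is admissible, and is
  -- positive on (0, L).
  set φ : ℝ → ℝ := fun s => 1 - Real.cos (2 * Real.pi / L * s) with hφ
  have hφs : ContDiff ℝ ∞ φ := by fun_prop
  have hφp : Function.Periodic φ L := fun s => by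
    have : 2 * Real.pi / L * (s + L) = 2 * Real.pi / L * s + 2 * Real.pi := by
      field_simp
    simp only [hφ, this, Real.cos_add_two_pi]
  set N : ℝ → ℝ := fun s => ∑ i, ∑ j, ‖w s i j‖ ^ 2 with hN
  have hNc : Continuous N := by
    have hc := hw.smooth.continuous
    have : ∀ i j, Continuous fun s => w s i j := fun i j =>
      (continuous_apply_apply i j).comp hc
    fun_prop
  have key := h0 _ (hw.rotate h hφs hφp) (by simp [hφ])
  have e : ∀ s, trH (Λ s) (br (w s) (((φ s : ℂ) * Complex.I) • (w s * Λ s))) =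
      -Complex.I * ((φ s * N s : ℝ) : ℂ) := by
    intro s
    rw [trH_br_test _ (h.sq s) (hw.anti s), trace_mul_self_of_hermitian (hw.herm s)]
    simp only [hN]
    push_cast
    ring
  simp only [e] at key
  rw [intervalIntegral.integral_const_mul, intervalIntegral.integral_ofReal] at key
  have key2 : ∫ s in (0 : ℝ)..L, φ s * N s = 0 := by
    simpa using key
  have hφ0 : ∀ s, 0 ≤ φ s := fun s => by
    have := Real.cos_le_one (2 * Real.pi / L * s)
    simp only [hφ]; linarith
  have hN0 : ∀ s, 0 ≤ N s := fun s => by positivity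
  have hIoo : ∀ s ∈ Set.Ioo 0 L, w s = 0 := by
    intro s hs
    by_contra hne
    have hpos : 0 < φ s := by
      refine lt_of_le_of_ne (hφ0 s) fun h1 => ?_
      have h2 : Real.cos (2 * Real.pi / L * s) = 1 := by simp only [hφ] at h1; linarith
      have h3 : 0 < 2 * Real.pi / L * s := mul_pos (by positivity) hs.1
      have h4 : 2 * Real.pi / L * s < 2 * Real.pi := by
        rw [div_mul_eq_mul_div, div_lt_iff₀ hL]
        exact mul_lt_mul_of_pos_left hs.2 (by positivity)
      exact h3.ne' ((Real.cos_eq_one_iff_of_lt_of_lt (by linarith) h4).1 h2)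
    refine (intervalIntegral.integral_pos hL ((hφs.continuous.mul hNc).continuousOn)
      (fun x _ => mul_nonneg (hφ0 x) (hN0 x))
      ⟨s, ⟨hs.1.le, hs.2.le⟩, mul_pos hpos (sum_norm_sq_pos hne)⟩).ne' key2
  -- The endpoints, where the weight vanishes, are reached by continuity; periodicity then covers
  -- the line.
  have hIcc : ∀ s ∈ Set.Icc 0 L, w s = 0 := by
    intro s hs
    rw [← closure_Ioo hL.ne] at hs
    exact closure_minimal (fun x hx => hIoo x hx)
      (isClosed_singleton.preimage hw.smooth.continuous (t := {0})) hs
  funext s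
  obtain ⟨y, hy, hys⟩ := hw.periodic.exists_mem_Ico₀ hL s
  rw [hys]
  exact hIcc y ⟨hy.1, hy.2.le⟩

/-! ## The first variation of the energy -/

/-- Each property is the t-derivative of an identity satisfied by all the fields; anticommutation
comes from Λ² = 1/4. -/
theorem isVariation_of_family {J : Set ℝ} {f : ℝ × ℝ → M2} (hJ : IsOpen J)
    (hf : ContDiffOn ℝ ∞ f (J ×ˢ Set.univ))
    (hT : ∀ t ∈ J, IsTangentField L fun s => f (t, s)) {t : ℝ} (ht : t ∈ J) :
    IsVariation L (fun s => f (t, s)) fun s => pd₁ f (t, s) where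
  smooth := contDiff_slice (ContDiffOn.pd₁ hJ hf) ht
  periodic s := by
    have h1 := hasDerivAt_fst hJ hf ht s
    refine (h1.congr_of_eventuallyEq ?_).unique (hasDerivAt_fst hJ hf ht (s + L)) |>.symm
    filter_upwards [hJ.mem_nhds ht] with τ hτ using (hT τ hτ).periodic s
  herm s := by
    have h1 := hasDerivAt_fst hJ hf ht s
    refine (HasDerivAt.conjTranspose h1).unique (h1.congr_of_eventuallyEq ?_)
    filter_upwards [hJ.mem_nhds ht] with τ hτ using (hT τ hτ).herm s
  anti s := by
    have h1 := hasDerivAt_fst hJ hf ht s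
    have h2 : HasDerivAt (fun τ => f (τ, s) * f (τ, s)) 0 t := by
      refine (hasDerivAt_const t ((1 / 4 : ℂ) • (1 : M2))).congr_of_eventuallyEq ?_
      filter_upwards [hJ.mem_nhds ht] with τ hτ using (hT τ hτ).sq s
    exact eq_neg_of_add_eq_zero_left ((h1.mul h1).unique h2)

/-- Differentiation under the integral, exchange of partials, and one integration by parts whose
boundary terms cancel by periodicity. -/
theorem hasDerivAt_energy {J : Set ℝ} {f : ℝ × ℝ → M2} (hJ : IsOpen J)
    (hf : ContDiffOn ℝ ∞ f (J ×ˢ Set.univ))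
    (hT : ∀ t ∈ J, IsTangentField L fun s => f (t, s)) {t : ℝ} (ht : t ∈ J) :
    HasDerivAt (fun τ => 1 / 2 * ∫ s in (0 : ℝ)..L, trH (pd₂ f (τ, s)) (pd₂ f (τ, s)))
      (-∫ s in (0 : ℝ)..L, trH (pd₂ (pd₂ f) (t, s)) (pd₁ f (t, s))) t := by
  have h2 := ContDiffOn.pd₂ hJ hf
  have h22 := ContDiffOn.pd₂ hJ h2
  have h1 := ContDiffOn.pd₁ hJ hf
  have h21 := ContDiffOn.pd₂ hJ h1
  have h12 := ContDiffOn.pd₁ hJ h2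
  have hE := contDiffOn_trH h2 h2
  have hd := (hasDerivAt_integral_of_contDiffOn hJ hE ht 0 L).const_mul (1 / 2 : ℂ)
  refine hd.congr_deriv ?_
  have e : ∀ s, pd₁ (fun p => trH (pd₂ f p) (pd₂ f p)) (t, s) =
      2 * trH (pd₂ f (t, s)) (pd₂ (pd₁ f) (t, s)) := by
    intro s
    rw [(hasDerivAt_fst hJ hE ht s).unique
      (hasDerivAt_trH (hasDerivAt_fst hJ h2 ht s) (hasDerivAt_fst hJ h2 ht s)),
      pd₁_pd₂ hJ hf ht s]
    simp only [trH]
    rw [Matrix.trace_mul_comm]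
    ring
  simp only [e]
  rw [intervalIntegral.integral_const_mul, ← mul_assoc]
  have c22 := (contDiff_slice h22 ht).continuous
  have c2 := (contDiff_slice h2 ht).continuous
  have c1 := (contDiff_slice h1 ht).continuous
  have c21 := (contDiff_slice h21 ht).continuous
  have hp1 : pd₁ f (t, L) = pd₁ f (t, 0) := by
    simpa using (isVariation_of_family hJ hf hT ht).periodic 0
  have hp2 : pd₂ f (t, L) = pd₂ f (t, 0) := by
    have := periodic_deriv (hT t ht).periodic 0
    rw [zero_add] at this
    exact (hasDerivAt_snd hJ hf ht L).deriv.symm.trans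
      (this.trans (hasDerivAt_snd hJ hf ht 0).deriv)
  have parts := intervalIntegral.integral_eq_sub_of_hasDerivAt (a := 0) (b := L)
    (fun s _ => hasDerivAt_trH (hasDerivAt_snd hJ h2 ht s) (hasDerivAt_snd hJ h1 ht s))
    (((continuous_trH c22 c1).add (continuous_trH c2 c21)).intervalIntegrable _ _)
  rw [intervalIntegral.integral_add ((continuous_trH c22 c1).intervalIntegrable _ _)
    ((continuous_trH c2 c21).intervalIntegrable _ _), hp1, hp2, sub_self] at parts
  rw [← eq_neg_of_add_eq_zero_right parts]
  norm_num

/-! ## Rotating a frame -/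

/-- The Cayley rotation generated by `W`, where `W² = -q`. -/
noncomputable def cayley (t q : ℝ) (W : M2) : M2 :=
  (1 + t ^ 2 * q / 4)⁻¹ • ((1 - t ^ 2 * q / 4) • (1 : M2) + t • W)

/-- Cayley–Hamilton for trace zero: W² = -det W, where det W = |W₀₀|² + |W₀₁|² is real and
nonnegative by skewness. -/
theorem skew_sq {W : M2} (h : Wᴴ = -W) (ht : W.trace = 0) :
    0 ≤ (-(W * W) 0 0).re ∧ W * W = (-(-(W * W) 0 0).re) • (1 : M2) ∧
      W.det = ((-(W * W) 0 0).re : ℂ) := by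
  have e00 := congrFun (congrFun h 0) 0
  have e01 := congrFun (congrFun h 0) 1
  have e10 := congrFun (congrFun h 1) 0
  have e11 := congrFun (congrFun h 1) 1
  rw [Matrix.trace_fin_two] at ht
  simp only [Matrix.conjTranspose_apply, Matrix.neg_apply, RCLike.star_def] at e00 e01 e10 e11
  have d : W 1 1 = -W 0 0 := by linear_combination ht
  have c : W 1 0 = -(starRingEnd ℂ) (W 0 1) := by rw [e10]; ring
  have a : W 0 0 * W 0 0 = -((Complex.normSq (W 0 0) : ℝ) : ℂ) := by
    rw [Complex.normSq_eq_conj_mul_self, e00]; ring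
  have b : W 0 1 * W 1 0 = -((Complex.normSq (W 0 1) : ℝ) : ℂ) := by
    rw [Complex.normSq_eq_conj_mul_self, c]; ring
  have k : (W * W) 0 0 = -((Complex.normSq (W 0 0) + Complex.normSq (W 0 1) : ℝ) : ℂ) := by
    rw [Matrix.mul_apply, Fin.sum_univ_two, a, b]; push_cast; ring
  have q : (-(W * W) 0 0).re = Complex.normSq (W 0 0) + Complex.normSq (W 0 1) := by
    rw [k, neg_neg, Complex.ofReal_re]
  rw [q]
  refine ⟨add_nonneg (Complex.normSq_nonneg _) (Complex.normSq_nonneg _), ?_, ?_⟩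
  · ext i j
    fin_cases i <;> fin_cases j
    · simp [k]
    · simp [Matrix.mul_apply, d]; ring
    · simp [Matrix.mul_apply, d]; ring
    · simp only [Matrix.mul_apply, Fin.sum_univ_two, d, Fin.mk_one]
      simp
      linear_combination a + b
  · rw [Matrix.det_fin_two, d]
    push_cast
    linear_combination -a - b

/-- Because W² = -q, `cayley t q W` equals (1 + tW/2)(1 - tW/2)⁻¹. Being rational in t, q and W, it
is smooth also where W vanishes. -/
theorem cayley_mem_SU2 {W : M2} {q : ℝ} (h : Wᴴ = -W) (ht : W.trace = 0) (hq : 0 ≤ q)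
    (hW : W * W = (-q) • (1 : M2)) (hd : W.det = (q : ℂ)) (t : ℝ) : cayley t q W ∈ SU2 := by
  have hpos : 0 < 1 + t ^ 2 * q / 4 := by positivity
  refine mem_SU2 ?_ ?_
  · simp only [cayley, Matrix.conjTranspose_smul, Matrix.conjTranspose_add,
      Matrix.conjTranspose_one, h, star_trivial, smul_mul_assoc, mul_smul_comm, add_mul, mul_add,
      one_mul, mul_one, mul_neg, smul_neg, hW, smul_smul, smul_add]
    have e2 : ∀ x y z u : ℝ, x = 1 - z → y = u → ∀ A : M2,
        x • (1 : M2) + y • A + -(u • A + (-z) • (1 : M2)) = 1 := by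
      rintro x y z u rfl rfl A; rw [sub_smul, one_smul, neg_smul]; abel
    apply e2
    · field_simp
      ring
    · ring
  · have hc : cayley t q W = (((1 + t ^ 2 * q / 4)⁻¹ : ℝ) : ℂ) •
        (((1 - t ^ 2 * q / 4 : ℝ) : ℂ) • (1 : M2) + (t : ℂ) • W) := by
      ext i j; simp [cayley]; ring
    rw [Matrix.det_fin_two] at hd
    rw [Matrix.trace_fin_two] at ht
    rw [hc, Matrix.det_smul, Matrix.det_fin_two]
    simp only [Matrix.add_apply, Matrix.smul_apply, Matrix.one_apply_eq, smul_eq_mul, mul_one,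
      Fintype.card_fin, ne_eq, zero_ne_one, not_false_eq_true, Matrix.one_apply_ne, one_ne_zero,
      mul_zero, zero_add]
    have hne : (4 + (t : ℂ) ^ 2 * q) ≠ 0 := by
      have : (4 + t ^ 2 * q : ℝ) ≠ 0 := by positivity
      exact_mod_cast this
    push_cast
    field_simp
    -- With a = 1 - t²q/4: det(a + tW) = a² + at·tr W + t² det W, and a² + t²q = (1 + t²q/4)².
    linear_combination (16 * (t : ℂ) ^ 2) * hd + (4 * (4 - t ^ 2 * q) * (t : ℂ)) * ht

theorem hasDerivAt_cayley (q : ℝ) (W : M2) : HasDerivAt (fun t => cayley t q W) W 0 := by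
  have h1 : HasDerivAt (fun t : ℝ => t ^ 2 * q / 4) 0 0 := by
    simpa using (((hasDerivAt_id (0 : ℝ)).pow 2).mul_const q).div_const 4
  have h2 := (h1.const_add 1).inv (by simp)
  have h3 := ((h1.const_sub 1).smul_const (1 : M2)).add ((hasDerivAt_id (0 : ℝ)).smul_const W)
  refine (h2.smul h3).congr_deriv ?_
  simp

/-- The rotation is built pointwise from v and Λ, so it inherits their periodicity and is trivial
wherever v vanishes. The latter preserves the condition R(0) = I. -/
theorem exists_rotation (h : IsTangentField L Λ) (hv : IsVariation L Λ v) :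
    ∃ S : ℝ → ℝ → M2, ContDiff ℝ ∞ (fun p : ℝ × ℝ => S p.1 p.2) ∧ (∀ t s, S t s ∈ SU2) ∧
      (∀ t, Function.Periodic (S t) L) ∧ (∀ s, S 0 s = 1) ∧ (∀ t s, v s = 0 → S t s = 1) ∧
      ∀ s, HasDerivAt (fun t => S t s * Λ s * (S t s)ᴴ) (v s) 0 := by
  -- The generator is chosen so that WΛ - ΛW = 2vΛ² - 2ΛvΛ = 4vΛ² = v.
  set W : ℝ → M2 := fun s => (2 : ℝ) • (v s * Λ s) with hW
  have hWs : ContDiff ℝ ∞ W := (hv.smooth.mul h.smooth).const_smul _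
  have hskew : ∀ s, (W s)ᴴ = -W s := fun s => by
    simp [hW, Matrix.conjTranspose_mul, hv.herm, h.herm, hv.anti]
  have htr : ∀ s, (W s).trace = 0 := fun s => by
    have e : (v s * Λ s).trace = -(v s * Λ s).trace := by
      conv_lhs => rw [hv.anti, Matrix.trace_neg, Matrix.trace_mul_comm]
    have : (v s * Λ s).trace = 0 := by linear_combination (1 / 2 : ℂ) * e
    simp [hW, this]
  set q : ℝ → ℝ := fun s => (-(W s * W s) 0 0).re with hq
  have hqs : ContDiff ℝ ∞ q := by
    have h1 : ContDiff ℝ ∞ fun s => W s * W s := hWs.mul hWs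
    have h2 := (smoothCurve_iff.2 h1) 0 0
    exact Complex.reCLM.contDiff.comp h2.neg
  have hsq := fun s => skew_sq (hskew s) (htr s)
  refine ⟨fun t s => cayley t (q s) (W s), ?_, fun t s => cayley_mem_SU2 (hskew s) (htr s)
    (hsq s).1 (hsq s).2.1 (hsq s).2.2 t, fun t s => ?_, fun s => ?_, fun t s hs => ?_, fun s => ?_⟩
  · have c1 : ContDiff ℝ ∞ fun p : ℝ × ℝ => p.1 ^ 2 * q p.2 / 4 :=
      ((contDiff_fst.pow 2).mul (hqs.comp contDiff_snd)).div_const 4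
    exact ((contDiff_const.add c1).inv fun p => (by
      have : 0 ≤ q p.2 := (hsq p.2).1
      positivity)).smul (((contDiff_const.sub c1).smul contDiff_const).add
        (contDiff_fst.smul (hWs.comp contDiff_snd)))
  · simp only [hq, hW, hv.periodic s, h.periodic s]
  · simp [cayley]
  · simp [hq, hW, cayley, hs]
  · have hc := hasDerivAt_cayley (q s) (W s)
    refine ((hc.mul_const (Λ s)).mul (HasDerivAt.conjTranspose hc)).congr_deriv ?_
    have e0 : cayley 0 (q s) (W s) = 1 := by simp [cayley]
    rw [e0, Matrix.conjTranspose_one, mul_one, one_mul, hskew]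
    simp only [hW, mul_neg, smul_mul_assoc, mul_smul_comm, mul_assoc, h.sq]
    rw [← mul_assoc (Λ s), ← neg_eq_iff_eq_neg.2 (hv.anti s), neg_mul, mul_assoc, h.sq,
      mul_smul_comm, mul_one, smul_neg, neg_neg, ← add_smul, ← smul_assoc]
    norm_num

end Variations

/-! ### The Hamiltonian argument common to the three geometries. -/

section Models

open scoped Matrix.Norms.Operator

/-- A space of Darboux curves with its energy, velocities and two-form, described through the
tangent field `T g` of a curve `g`. `Sol g V v` says that the velocity of any variation of `g` with
variation `v` of the tangent field is represented by `V`. -/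
structure Model (L : ℝ) where
  Curves : Set M2 → Set (ℝ → M2)
  Vel : (ℝ → ℝ → M2) → ℝ → (ℝ → M2) → Prop
  energy : (ℝ → M2) → ℝ
  Om : (ℝ → M2) → (ℝ → M2) → (ℝ → M2) → ℂ
  T : (ℝ → M2) → ℝ → M2
  Sol : (ℝ → M2) → (ℝ → M2) → (ℝ → M2) → Prop
  mono : ∀ {N}, N ⊆ SU2 → Curves N ⊆ Curves SU2
  isTangentField : ∀ {g}, g ∈ Curves SU2 → IsTangentField L (T g)
  T_zero : ∀ {g}, g ∈ Curves {1} → T g 0 = B1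
  contDiffOn_T : ∀ {J σ}, SmoothFamily (Curves SU2) J σ →
    ContDiffOn ℝ ∞ (fun p : ℝ × ℝ => T (σ p.1) p.2) (J ×ˢ Set.univ)
  vel_iff : ∀ {J σ t V}, SmoothFamily (Curves SU2) J σ → t ∈ J →
    (Vel σ t V ↔ Sol (σ t) V fun s => deriv (fun τ => T (σ τ) s) t)
  sol_left : ∀ {g V W v}, g ∈ Curves SU2 → Sol g V v → Sol g W v → V = W
  sol_right : ∀ {g V v w}, Sol g V v → Sol g V w → v = w
  sol_exists : ∀ {g v}, g ∈ Curves SU2 → Continuous v → ∃ V, Sol g V v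
  om_eq : ∀ {g V W v w}, Sol g V v → Sol g W w →
    Om g V W = -Complex.I * ∫ s in (0 : ℝ)..L, trH (T g s) (br (v s) (w s))
  energy_eq : ∀ {g}, g ∈ Curves SU2 →
    (energy g : ℂ) = 1 / 2 * ∫ s in (0 : ℝ)..L, trH (deriv (T g) s) (deriv (T g) s)
  lift : ∀ {N g}, N ⊆ SU2 → g ∈ Curves N → ∀ S : ℝ → ℝ → M2,
    ContDiff ℝ ∞ (fun p : ℝ × ℝ => S p.1 p.2) → (∀ t s, S t s ∈ SU2) →
    (∀ t, Function.Periodic (S t) L) → (∀ s, S 0 s = 1) → (∀ R ∈ N, ∀ t, S t 0 * R ∈ N) →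
    ∃ σ : ℝ → ℝ → M2, SmoothFamily (Curves N) Set.univ σ ∧ σ 0 = g ∧
      ∀ t s, T (σ t) s = S t s * T g s * (S t s)ᴴ

theorem one_subset_SU2 : ({1} : Set M2) ⊆ SU2 := by
  rintro _ rfl
  exact (Matrix.specialUnitaryGroup (Fin 2) ℂ).one_mem

theorem SmoothFamily.mono {M M' : Set (ℝ → M2)} {J : Set ℝ} {σ : ℝ → ℝ → M2} (h : M ⊆ M')
    (hσ : SmoothFamily M J σ) : SmoothFamily M' J σ :=
  ⟨hσ.1, fun t ht => h (hσ.2.1 t ht), hσ.2.2⟩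

theorem SmoothFamily.shift {M : Set (ℝ → M2)} {J : Set ℝ} {σ : ℝ → ℝ → M2}
    (hσ : SmoothFamily M J σ) (t : ℝ) :
    SmoothFamily M ((t + ·) ⁻¹' J) fun τ => σ (t + τ) := by
  refine ⟨hσ.1.preimage (by fun_prop), fun τ hτ => hσ.2.1 _ hτ, fun i j => ?_⟩
  refine (hσ.2.2 i j).comp (f := fun p : ℝ × ℝ => (t + p.1, p.2)) ?_ fun p hp => ⟨hp.1, trivial⟩
  exact ((contDiff_const.add contDiff_fst).prodMk contDiff_snd).contDiffOn

variable {L : ℝ} (𝓜 : Model L)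

namespace Model

variable {𝓜} {J : Set ℝ} {σ : ℝ → ℝ → M2} {g F : ℝ → M2} {N : Set M2}

theorem isVariation_deriv (hσ : SmoothFamily (𝓜.Curves SU2) J σ) {t : ℝ} (ht : t ∈ J) :
    IsVariation L (𝓜.T (σ t)) fun s => deriv (fun τ => 𝓜.T (σ τ) s) t := by
  have hf := 𝓜.contDiffOn_T hσ
  have h := isVariation_of_family hσ.1 hf (fun τ hτ => 𝓜.isTangentField (hσ.2.1 τ hτ)) ht
  have e : (fun s => deriv (fun τ => 𝓜.T (σ τ) s) t) =
      fun s => pd₁ (fun p : ℝ × ℝ => 𝓜.T (σ p.1) p.2) (t, s) :=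
    funext fun s => (hasDerivAt_fst hσ.1 hf ht s).deriv
  rw [e]
  exact h

theorem hasDerivAt_T (hσ : SmoothFamily (𝓜.Curves SU2) J σ) {t : ℝ} (ht : t ∈ J) (s : ℝ) :
    HasDerivAt (fun τ => 𝓜.T (σ τ) s) (deriv (fun τ => 𝓜.T (σ τ) s) t) t :=
  (hasDerivAt_fst hσ.1 (𝓜.contDiffOn_T hσ) ht s).differentiableAt.hasDerivAt

theorem hasDerivAt_energy_comp (hσ : SmoothFamily (𝓜.Curves SU2) J σ) {t : ℝ} (ht : t ∈ J) :
    HasDerivAt (fun τ => ((𝓜.energy (σ τ) : ℝ) : ℂ))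
      (-∫ s in (0 : ℝ)..L, trH (deriv (deriv (𝓜.T (σ t))) s)
        (deriv (fun τ => 𝓜.T (σ τ) s) t)) t := by
  have hf := 𝓜.contDiffOn_T hσ
  have hd : ∀ τ ∈ J, deriv (𝓜.T (σ τ)) =
      fun s => pd₂ (fun p : ℝ × ℝ => 𝓜.T (σ p.1) p.2) (τ, s) := fun τ hτ =>
    funext fun s => (hasDerivAt_snd hσ.1 hf hτ s).deriv
  have h := hasDerivAt_energy hσ.1 hf (fun τ hτ => 𝓜.isTangentField (hσ.2.1 τ hτ)) ht
  refine (h.congr_of_eventuallyEq ?_).congr_deriv ?_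
  · filter_upwards [hσ.1.mem_nhds ht] with τ hτ
    rw [𝓜.energy_eq (hσ.2.1 τ hτ), hd τ hτ]
  · congr 1
    refine intervalIntegral.integral_congr fun s _ => ?_
    rw [hd t ht]
    exact congrArg₂ trH (hasDerivAt_snd hσ.1 (ContDiffOn.pd₂ hσ.1 hf) ht s).deriv.symm
      (hasDerivAt_fst hσ.1 hf ht s).deriv.symm

/-- The first variation matches the two-form through `trH_br_br`, the factors -i and i cancelling. F
need not be tangent to the smaller space. -/
theorem hamiltonEq_of_sol (hN : N ⊆ SU2) (hF : 𝓜.Sol g F (heisenbergField (𝓜.T g))) :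
    HamiltonEq (𝓜.Curves N) 𝓜.Vel 𝓜.energy 𝓜.Om g F := by
  intro J σ V hσ h0 hg hV
  have hσ' := hσ.mono (𝓜.mono hN)
  subst hg
  refine (hasDerivAt_energy_comp hσ' h0).congr_deriv ?_
  rw [𝓜.om_eq hF ((𝓜.vel_iff hσ' h0).1 hV), ← intervalIntegral.integral_const_mul,
    ← intervalIntegral.integral_neg]
  refine intervalIntegral.integral_congr fun s _ => ?_
  simp only [heisenbergField]
  rw [br_smul_left, trH_smul_right,
    trH_br_br ((𝓜.isTangentField (hσ'.2.1 0 h0)).sq s) ((isVariation_deriv hσ' h0).anti s),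
    ← mul_assoc]
  simp

/-- Every variation of the tangent field is realised by a smooth family of curves. -/
theorem exists_family (hN : N ⊆ SU2) (hg : g ∈ 𝓜.Curves N) {v : ℝ → M2}
    (hv : IsVariation L (𝓜.T g) v) (h0 : v 0 = 0 ∨ N = SU2) :
    ∃ σ : ℝ → ℝ → M2, SmoothFamily (𝓜.Curves N) Set.univ σ ∧ σ 0 = g ∧
      ∀ V, 𝓜.Vel σ 0 V ↔ 𝓜.Sol g V v := by
  obtain ⟨S, hS, hSU, hSp, hS0, hSv, hSd⟩ :=
    exists_rotation (𝓜.isTangentField (𝓜.mono hN hg)) hv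
  obtain ⟨σ, hσ, hσ0, hT⟩ := 𝓜.lift hN hg S hS hSU hSp hS0 (by
    rintro R hR t
    rcases h0 with h0 | rfl
    · rwa [hSv t 0 h0, one_mul]
    · exact (Matrix.specialUnitaryGroup (Fin 2) ℂ).mul_mem (hSU t 0) hR)
  refine ⟨σ, hσ, hσ0, fun V => ?_⟩
  rw [𝓜.vel_iff (hσ.mono (𝓜.mono hN)) (Set.mem_univ 0), hσ0]
  have e : (fun s => deriv (fun τ => 𝓜.T (σ τ) s) 0) = v :=
    funext fun s => by simp only [hT]; exact (hSd s).deriv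
  rw [e]

theorem isTangent_of_sol (hN : N ⊆ SU2) (hg : g ∈ 𝓜.Curves N) {v V : ℝ → M2}
    (hv : IsVariation L (𝓜.T g) v) (h0 : v 0 = 0 ∨ N = SU2) (hV : 𝓜.Sol g V v) :
    IsTangent (𝓜.Curves N) 𝓜.Vel g V := by
  obtain ⟨σ, hσ, hσ0, h⟩ := exists_family hN hg hv h0
  exact ⟨Set.univ, σ, hσ, trivial, hσ0, (h V).2 hV⟩

theorem exists_isVariation_of_isTangent (hN : N ⊆ SU2)
    (hF : IsTangent (𝓜.Curves N) 𝓜.Vel g F) :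
    ∃ v, IsVariation L (𝓜.T g) v ∧ 𝓜.Sol g F v ∧ (N = {1} → v 0 = 0) := by
  obtain ⟨J, σ, hσ, h0, rfl, hV⟩ := hF
  have hσ' := hσ.mono (𝓜.mono hN)
  refine ⟨_, isVariation_deriv hσ' h0, (𝓜.vel_iff hσ' h0).1 hV, ?_⟩
  rintro rfl
  -- With R(0) = I along the family, the tangent at s = 0 stays equal to `B1`.
  refine HasDerivAt.deriv ((hasDerivAt_const (0 : ℝ) B1).congr_of_eventuallyEq ?_)
  filter_upwards [hσ.1.mem_nhds h0] with τ hτ using 𝓜.T_zero (hσ.2.1 τ hτ)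

/-- F may be tangent to the larger space while the equation is tested only on `Curves N`; the
fundamental lemma still applies, since it tests only with variations vanishing at 0. -/
theorem hamiltonEq_iff (hL : 0 < L) (hN : N ⊆ SU2) (hg : g ∈ 𝓜.Curves N)
    (hF : IsTangent (𝓜.Curves SU2) 𝓜.Vel g F) :
    HamiltonEq (𝓜.Curves N) 𝓜.Vel 𝓜.energy 𝓜.Om g F ↔
      𝓜.Sol g F (heisenbergField (𝓜.T g)) := by
  refine ⟨fun h => ?_, hamiltonEq_of_sol hN⟩
  have hg' := 𝓜.mono hN hg
  have hT := 𝓜.isTangentField hg'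
  have hH := hT.isVariation_heisenbergField
  obtain ⟨u, hu, hFu, -⟩ := exists_isVariation_of_isTangent subset_rfl hF
  obtain ⟨F₀, hF₀⟩ := 𝓜.sol_exists hg' hH.smooth.continuous
  have hz : u - heisenbergField (𝓜.T g) = 0 := by
    refine (hu.sub hH).eq_zero hL hT fun v hv hv0 => ?_
    obtain ⟨σ, hσ, hσ0, hVel⟩ := exists_family hN hg hv (Or.inl hv0)
    obtain ⟨V, hV⟩ := 𝓜.sol_exists hg' hv.smooth.continuous
    have h1 := (h Set.univ σ V hσ trivial hσ0 ((hVel V).2 hV)).unique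
      (hamiltonEq_of_sol hN hF₀ Set.univ σ V hσ trivial hσ0 ((hVel V).2 hV))
    rw [𝓜.om_eq hFu hV, 𝓜.om_eq hF₀ hV] at h1
    have h2 := mul_left_cancel₀ (neg_ne_zero.2 Complex.I_ne_zero) h1
    have c : ∀ w : ℝ → M2, IsVariation L (𝓜.T g) w → IntervalIntegrable
        (fun s => trH (𝓜.T g s) (br (w s) (v s))) MeasureTheory.volume 0 L := fun w hw =>
      (continuous_trH hT.smooth.continuous
        (contDiff_br hw.smooth hv.smooth).continuous).intervalIntegrable _ _
    simp only [Pi.sub_apply, br_sub_left, trH_sub_right]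
    rw [intervalIntegral.integral_sub (c _ hu) (c _ hH), h2, sub_self]
  rwa [← sub_eq_zero.1 hz]

/-- F determines its variation v, so the only obstruction is v(0) = 0; when that holds,
`exists_family` realises v without moving R(0). -/
theorem isTangent_one_iff (hg : g ∈ 𝓜.Curves {1})
    (hF : 𝓜.Sol g F (heisenbergField (𝓜.T g))) :
    IsTangent (𝓜.Curves {1}) 𝓜.Vel g F ↔ br (deriv (deriv (𝓜.T g)) 0) (𝓜.T g 0) = 0 := by
  have hN := one_subset_SU2
  have e : heisenbergField (𝓜.T g) 0 = 0 ↔ br (deriv (deriv (𝓜.T g)) 0) (𝓜.T g 0) = 0 := by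
    simp [heisenbergField]
  rw [← e]
  constructor
  · intro h
    obtain ⟨v, -, hv, hv0⟩ := exists_isVariation_of_isTangent hN h
    rw [𝓜.sol_right hF hv]
    exact hv0 rfl
  · intro h
    exact isTangent_of_sol hN hg
      (𝓜.isTangentField (𝓜.mono hN hg)).isVariation_heisenbergField (Or.inl h) hF

theorem isHamiltonianVector_iff (hL : 0 < L) (hg : g ∈ 𝓜.Curves SU2) :
    IsHamiltonianVector (𝓜.Curves SU2) 𝓜.Vel 𝓜.energy 𝓜.Om g F ↔
      𝓜.Sol g F (heisenbergField (𝓜.T g)) := by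
  refine ⟨fun h => (hamiltonEq_iff hL subset_rfl hg h.1).1 h.2, fun h => ⟨?_, ?_⟩⟩
  · exact isTangent_of_sol subset_rfl hg
      (𝓜.isTangentField hg).isVariation_heisenbergField (Or.inr rfl) h
  · exact hamiltonEq_of_sol subset_rfl h

theorem isHamiltonianFlow_iff (hL : 0 < L) (hN : N ⊆ SU2)
    (hσ : SmoothFamily (𝓜.Curves N) J σ) :
    IsHamiltonianFlow (𝓜.Curves N) 𝓜.Vel 𝓜.energy 𝓜.Om J σ ↔
      ∀ t ∈ J, ∀ s, HasDerivAt (fun τ => 𝓜.T (σ τ) s) (heisenbergField (𝓜.T (σ t)) s) t := by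
  have hσ' := hσ.mono (𝓜.mono hN)
  constructor
  · rintro ⟨-, h⟩ t ht s
    obtain ⟨F, ⟨⟨J', ρ, hρ, h0, hρ0, hv⟩, hE⟩, hF⟩ := h t ht
    have h1 := (hamiltonEq_iff hL hN (hσ.2.1 t ht)
      ⟨J', ρ, hρ.mono (𝓜.mono hN), h0, hρ0, hv⟩).1 hE
    have h2 := 𝓜.sol_right h1 ((𝓜.vel_iff hσ' ht).1 hF)
    rw [h2]
    exact hasDerivAt_T hσ' ht s
  · refine fun h => ⟨hσ, fun t ht => ?_⟩
    have hT := 𝓜.isTangentField (hσ'.2.1 t ht)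
    obtain ⟨F, hF⟩ := 𝓜.sol_exists (hσ'.2.1 t ht)
      hT.isVariation_heisenbergField.smooth.continuous
    have e : heisenbergField (𝓜.T (σ t)) = fun s => deriv (fun τ => 𝓜.T (σ τ) s) t :=
      funext fun s => (h t ht s).deriv.symm
    have h0 : (0 : ℝ) ∈ (t + ·) ⁻¹' J := by simpa using ht
    -- The flow shifted in time witnesses that F is tangent, so for R(0) = I no separate condition
    -- at s = 0 has to be checked.
    refine ⟨F, ⟨⟨_, _, hσ.shift t, h0, by simp, ?_⟩, hamiltonEq_of_sol hN hF⟩,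
      (𝓜.vel_iff hσ' ht).2 (e ▸ hF)⟩
    rw [𝓜.vel_iff (hσ'.shift t) h0]
    have e' : (fun s => deriv (fun τ => 𝓜.T (σ (t + τ)) s) 0) = heisenbergField (𝓜.T (σ t)) :=
      funext fun s => by
        refine (deriv_comp_const_add (fun τ => 𝓜.T (σ τ) s) t 0).trans ?_
        rw [add_zero, (h t ht s).deriv]
    simp only [add_zero]
    rw [e']
    exact hF

end Model

end Models

/-! ### Reconstruction of curves from their tangent fields. -/

section Lifting

open scoped Matrix.Norms.Operator

variable {L : ℝ}

theorem eq_of_hasDerivAt_eq {E : Type*} [NormedAddCommGroup E] [NormedSpace ℝ E] {V W D : ℝ → E}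
    (hV : ∀ s, HasDerivAt V (D s) s) (hW : ∀ s, HasDerivAt W (D s) s) (h0 : V 0 = W 0) :
    V = W := by
  have hd : ∀ s, HasDerivAt (V - W) 0 s := fun s => by simpa using (hV s).sub (hW s)
  funext s
  have := is_const_of_deriv_eq_zero (fun s => (hd s).differentiableAt) (fun s => (hd s).deriv) s 0
  simp only [Pi.sub_apply, h0, sub_self] at this
  exact sub_eq_zero.1 this

theorem linear_ode_unique {𝔸 : Type*} [NormedRing 𝔸] [NormedAlgebra ℝ 𝔸] [CompleteSpace 𝔸]
    {G H A : ℝ → 𝔸} (hG : ∀ s, HasDerivAt G (G s * A s) s)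
    (hH : ∀ s, HasDerivAt H (H s * A s) s) (hu : ∀ s, IsUnit (H s)) (h0 : G 0 = H 0) : G = H := by
  have hd : ∀ s, HasDerivAt (fun x => G x * Ring.inverse (H x)) 0 s := fun s => by
    refine ((hG s).mul (hasDerivAt_ringInverse (hH s) (hu s))).congr_deriv ?_
    rw [show Ring.inverse (H s) * (H s * A s) = A s by
      rw [← mul_assoc, Ring.inverse_mul_cancel _ (hu s), one_mul]]
    noncomm_ring
  have h1 := eq_of_hasDerivAt_eq hd (fun s => hasDerivAt_const s (1 : 𝔸))
    (by rw [h0, Ring.mul_inverse_cancel _ (hu 0)])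
  funext s
  have h2 : G s * Ring.inverse (H s) = 1 := congrFun h1 s
  rw [← mul_one (G s), ← Ring.inverse_mul_cancel _ (hu s), ← mul_assoc, h2, one_mul]

/-- Liouville's formula: (det G)' = tr(A) det G. -/
theorem det_eq_one_of_linear_ode {G A : ℝ → M2} (hG : ∀ s, HasDerivAt G (G s * A s) s)
    (hA : ∀ s, (A s).trace = 0) (h0 : G 0 = 1) (s : ℝ) : (G s).det = 1 := by
  have e : ∀ s i j, HasDerivAt (fun x => G x i j) (G s i 0 * A s 0 j + G s i 1 * A s 1 j) s := by
    intro s i j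
    have := (hasDD_iff.2 (hG s)) i j
    rwa [Matrix.mul_apply, Fin.sum_univ_two] at this
  have hd : ∀ s, HasDerivAt (fun x => (G x).det) 0 s := by
    intro s
    simp only [Matrix.det_fin_two]
    refine (((e s 0 0).mul (e s 1 1)).sub ((e s 0 1).mul (e s 1 0))).congr_deriv ?_
    have ht := hA s
    rw [Matrix.trace_fin_two] at ht
    linear_combination (G s 0 0 * G s 1 1 - G s 0 1 * G s 1 0) * ht
  have h1 := eq_of_hasDerivAt_eq hd (fun s => hasDerivAt_const s (1 : ℂ)) (by simp [h0])
  exact congrFun h1 s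

/-- Curves in `SL₂(ℂ)` with prescribed logarithmic derivative depending smoothly on a parameter. -/
theorem exists_smooth_lift {A : ℝ × ℝ → M2} (hA : ContDiff ℝ ∞ A) (ht : ∀ p, (A p).trace = 0) :
    ∃ G : ℝ × ℝ → M2, ContDiff ℝ ∞ G ∧ (∀ t, G (t, 0) = 1) ∧ (∀ p, (G p).det = 1) ∧
      ∀ t s, HasDerivAt (fun x => G (t, x)) (G (t, s) * A (t, s)) s := by
  have : CompleteSpace M2 := FiniteDimensional.complete ℝ M2
  have hd := hasDerivAt_propagator hA.continuous
  have h1 : ∀ p, (propagator A p).det = 1 := fun p =>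
    det_eq_one_of_linear_ode (hd p.1) (fun s => ht (p.1, s)) (propagator_zero A p.1) p.2
  refine ⟨propagator A, ?_, propagator_zero A, h1, hd⟩
  exact contDiff_of_linear_ode hA (continuous_propagator hA.continuous) hd (propagator_zero A)
    fun p => (Matrix.isUnit_iff_isUnit_det _).2 (by rw [h1 p]; exact isUnit_one)

theorem contDiffOn_family {M : Set (ℝ → M2)} {J : Set ℝ} {σ : ℝ → ℝ → M2}
    (hσ : SmoothFamily M J σ) :
    ContDiffOn ℝ ∞ (fun p : ℝ × ℝ => σ p.1 p.2) (J ×ˢ Set.univ) :=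
  contDiffOn_entries.1 hσ.2.2

theorem dd_family {M : Set (ℝ → M2)} {J : Set ℝ} {σ : ℝ → ℝ → M2} (hσ : SmoothFamily M J σ)
    {t : ℝ} (ht : t ∈ J) (s : ℝ) :
    dd (σ t) s = pd₂ (fun p : ℝ × ℝ => σ p.1 p.2) (t, s) :=
  (hasDD_iff.2 (hasDerivAt_snd hσ.1 (contDiffOn_family hσ) ht s)).dd_eq

theorem smoothFamily_univ {M : Set (ℝ → M2)} {G : ℝ × ℝ → M2} (hG : ContDiff ℝ ∞ G)
    (hM : ∀ t, (fun s => G (t, s)) ∈ M) : SmoothFamily M Set.univ fun t s => G (t, s) :=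
  ⟨isOpen_univ, fun t _ => hM t, contDiffOn_entries.2 hG.contDiffOn⟩

theorem isTangentField_of_frame {Λ R : ℝ → M2} (hR : SmoothCurve R) (hU : ∀ s, R s ∈ SU2)
    (hΛ : ∀ s, Λ s = R s * B1 * (R s)ᴴ) (hp : Function.Periodic Λ L) : IsTangentField L Λ where
  smooth := by
    have h := smoothCurve_iff.1 hR
    rw [funext hΛ]
    exact (h.mul contDiff_const).mul (contDiff_conjTranspose h)
  periodic := hp
  herm s := by rw [hΛ]; exact frame_conjTranspose _
  sq s := by rw [hΛ]; exact frame_sq (hU s)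

theorem smoothCurve_frame_mul {S : ℝ → ℝ → M2} {R : ℝ → M2}
    (hS : ContDiff ℝ ∞ fun p : ℝ × ℝ => S p.1 p.2) (hR : SmoothCurve R) (t : ℝ) :
    SmoothCurve fun s => S t s * R s :=
  smoothCurve_iff.2 ((hS.comp (contDiff_const.prodMk contDiff_id)).mul (smoothCurve_iff.1 hR))

theorem contDiff_rotated {S : ℝ → ℝ → M2} {Λ : ℝ → M2}
    (hS : ContDiff ℝ ∞ fun p : ℝ × ℝ => S p.1 p.2) (hΛ : ContDiff ℝ ∞ Λ) :
    ContDiff ℝ ∞ fun p : ℝ × ℝ => S p.1 p.2 * Λ p.2 * (S p.1 p.2)ᴴ :=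
  (hS.mul (hΛ.comp contDiff_snd)).mul (contDiff_conjTranspose hS)

theorem rotated_frame {S R B : M2} : S * (R * B * Rᴴ) * Sᴴ = S * R * B * (S * R)ᴴ := by
  rw [Matrix.conjTranspose_mul]; noncomm_ring

theorem sq_sqrt_trH_self {A : M2} (h : Aᴴ = A) :
    (((√(trH A A).re) ^ 2 : ℝ) : ℂ) = trH A A := by
  have e : trH A A = ((2 * ∑ i, ∑ j, ‖A i j‖ ^ 2 : ℝ) : ℂ) := by
    rw [trH, trace_mul_self_of_hermitian h]; push_cast; rfl
  rw [e, Complex.ofReal_re, Real.sq_sqrt (by positivity)]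

/-- `V(0) = 0` and `dV/ds = v`. -/
def PrimSol (_g V v : ℝ → M2) : Prop := V 0 = 0 ∧ ∀ s, HasDerivAt V (v s) s

theorem PrimSol.left {g V W v : ℝ → M2} (hV : PrimSol g V v) (hW : PrimSol g W v) : V = W :=
  eq_of_hasDerivAt_eq hV.2 hW.2 (hV.1.trans hW.1.symm)

theorem PrimSol.right {g V v w : ℝ → M2} (hV : PrimSol g V v) (hW : PrimSol g V w) : v = w :=
  funext fun s => (hV.2 s).unique (hW.2 s)

theorem PrimSol.dd_eq {g V v : ℝ → M2} (hV : PrimSol g V v) (s : ℝ) : dd V s = v s :=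
  (hasDD_iff.2 (hV.2 s)).dd_eq

theorem PrimSol.exists (g : ℝ → M2) {v : ℝ → M2} (hv : Continuous v) : ∃ V, PrimSol g V v :=
  have : CompleteSpace M2 := FiniteDimensional.complete ℝ M2
  ⟨fun s => ∫ x in (0 : ℝ)..s, v x, by simp, hasDerivAt_primitive hv 0⟩

theorem dd_dd_eq {Λ : ℝ → M2} (h : ContDiff ℝ ∞ Λ) : dd (dd Λ) = deriv (deriv Λ) := by
  rw [dd_eq_deriv_of_contDiff h, dd_eq_deriv_of_contDiff (contDiff_deriv h)]

theorem primSol_field (g : ℝ → M2) {Λ : ℝ → M2} (h : ContDiff ℝ ∞ Λ) :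
    PrimSol g (fun s => Complex.I • intM (fun x => br (dd (dd Λ) x) (Λ x)) s)
      (heisenbergField Λ) := by
  have : CompleteSpace M2 := FiniteDimensional.complete ℝ M2
  have hc : Continuous fun x => br (deriv (deriv Λ) x) (Λ x) :=
    (contDiff_br (contDiff_deriv (contDiff_deriv h)) h).continuous
  have e : (fun s => Complex.I • intM (fun x => br (dd (dd Λ) x) (Λ x)) s) =
      fun s => Complex.I • ∫ x in (0 : ℝ)..s, br (deriv (deriv Λ) x) (Λ x) := by
    funext s
    rw [dd_dd_eq h, intM_eq hc]
  rw [e]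
  exact ⟨by simp, fun s => (hasDerivAt_primitive hc 0 s).const_smul Complex.I⟩

theorem heisenberg_iff {J : Set ℝ} {Λ : ℝ → ℝ → M2} (h : ∀ t ∈ J, ContDiff ℝ ∞ (Λ t)) :
    Heisenberg Complex.I J Λ ↔
      ∀ t ∈ J, ∀ s, HasDerivAt (fun τ => Λ τ s) (heisenbergField (Λ t) s) t := by
  unfold Heisenberg
  refine forall₂_congr fun t ht => forall_congr' fun s => ?_
  rw [hasDD_iff, dd_dd_eq (h t ht)]
  rfl

end Lifting

/-! ### Hyperbolic curves and the literal flow. -/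

section Hyperbolic

open scoped Matrix.Norms.Operator

variable {L : ℝ} {g : ℝ → M2} {N : Set M2}

theorem HypCurves.isTangentField (hg : g ∈ HypCurves L SU2) : IsTangentField L (tanH g) := by
  obtain ⟨-, -, -, ⟨R, hR, hU, -, hΛ⟩, hp⟩ := hg
  exact isTangentField_of_frame hR hU hΛ hp

theorem HypCurves.trace (hg : g ∈ HypCurves L SU2) (s : ℝ) : (tanH g s).trace = 0 := by
  obtain ⟨-, -, -, ⟨R, hR, hU, -, hΛ⟩, hp⟩ := hg
  rw [hΛ]
  exact frame_trace (hU s)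

theorem isUnit_of_det_eq_one {A : M2} (h : A.det = 1) : IsUnit A :=
  (Matrix.isUnit_iff_isUnit_det _).2 (by rw [h]; exact isUnit_one)

theorem mul_tanH (h : ∀ s, (g s).det = 1) (s : ℝ) : g s * tanH g s = dd g s := by
  rw [tanH, ← mul_assoc, Matrix.mul_nonsing_inv _ (by rw [h s]; exact isUnit_one), one_mul]

theorem HypCurves.hasDerivAt (hg : g ∈ HypCurves L N) (s : ℝ) :
    HasDerivAt g (g s * tanH g s) s := by
  rw [mul_tanH hg.2.1, dd_eq_deriv_of_contDiff (smoothCurve_iff.1 hg.1)]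
  exact ((smoothCurve_iff.1 hg.1).differentiable (by simp) s).hasDerivAt

theorem contDiffOn_tanH {J : Set ℝ} {σ : ℝ → ℝ → M2} (hσ : SmoothFamily (HypCurves L N) J σ) :
    ContDiffOn ℝ ∞ (fun p : ℝ × ℝ => tanH (σ p.1) p.2) (J ×ˢ Set.univ) := by
  have hf := contDiffOn_family hσ
  refine ((contDiff_adjugate.comp_contDiffOn hf).mul (ContDiffOn.pd₂ hσ.1 hf)).congr ?_
  rintro ⟨t, s⟩ ⟨ht, -⟩
  simp only [tanH]
  rw [inv_eq_adjugate ((hσ.2.1 t ht).2.1 s), dd_family hσ ht]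
  rfl

theorem hypVel_iff {J : Set ℝ} {σ : ℝ → ℝ → M2} (hσ : SmoothFamily (HypCurves L N) J σ)
    {t : ℝ} (ht : t ∈ J) {V : ℝ → M2} :
    HypVel σ t V ↔ PrimSol (σ t) V fun s => deriv (fun τ => tanH (σ τ) s) t := by
  unfold HypVel PrimSol
  refine and_congr_right fun _ => forall_congr' fun s => ?_
  rw [hasDD_iff, dd_eq_deriv (hasDerivAt_fst hσ.1 (contDiffOn_tanH hσ) ht s).differentiableAt]

/-- The family solves ∂G/∂s = G·SΛS* from the identity; at t = 0 this is the equation of g, so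
uniqueness returns g. The rotated frame is SR. -/
theorem hyp_lift (hg : g ∈ HypCurves L N) (S : ℝ → ℝ → M2)
    (hS : ContDiff ℝ ∞ fun p : ℝ × ℝ => S p.1 p.2) (hU : ∀ t s, S t s ∈ SU2)
    (hp : ∀ t, Function.Periodic (S t) L) (h0 : ∀ s, S 0 s = 1)
    (hSN : ∀ R ∈ N, ∀ t, S t 0 * R ∈ N) :
    ∃ σ : ℝ → ℝ → M2, SmoothFamily (HypCurves L N) Set.univ σ ∧ σ 0 = g ∧
      ∀ t s, tanH (σ t) s = S t s * tanH g s * (S t s)ᴴ := by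
  have : CompleteSpace M2 := FiniteDimensional.complete ℝ M2
  obtain ⟨hgs, hgd, hg0, ⟨R, hR, hRU, hRN, hΛ⟩, hgp⟩ := id hg
  have hg' : g ∈ HypCurves L SU2 := ⟨hgs, hgd, hg0, ⟨R, hR, hRU, hRU 0, hΛ⟩, hgp⟩
  have hT := HypCurves.isTangentField hg'
  obtain ⟨G, hG, hG0, hGd, hGA⟩ := exists_smooth_lift (contDiff_rotated hS hT.smooth) (by
    intro p
    rw [Matrix.trace_mul_comm, ← mul_assoc, SU2.conjTranspose_mul (hU _ _), one_mul]
    exact HypCurves.trace hg' p.2)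
  have hsl : ∀ t, SmoothCurve fun s => G (t, s) := fun t =>
    smoothCurve_iff.2 (hG.comp (contDiff_const.prodMk contDiff_id))
  have htan : ∀ t s, tanH (fun s => G (t, s)) s = S t s * tanH g s * (S t s)ᴴ := by
    intro t s
    rw [tanH, (hasDD_iff.2 (hGA t s)).dd_eq, ← mul_assoc,
      Matrix.nonsing_inv_mul _ (by rw [hGd]; exact isUnit_one), one_mul]
  refine ⟨fun t s => G (t, s), smoothFamily_univ hG fun t => ⟨hsl t, fun s => hGd _, hG0 t,
    ⟨fun s => S t s * R s, smoothCurve_frame_mul hS hR t, fun s =>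
      (Matrix.specialUnitaryGroup (Fin 2) ℂ).mul_mem (hU t s) (hRU s), hSN _ hRN t,
      fun s => ?_⟩, fun s => ?_⟩, ?_, htan⟩
  · rw [htan, hΛ, rotated_frame]
  · rw [htan, htan, hp t s, hgp s]
  · refine linear_ode_unique (A := tanH g) (fun s => ?_) (HypCurves.hasDerivAt hg)
      (fun s => isUnit_of_det_eq_one (hgd s)) ((hG0 0).trans hg0.symm)
    have := hGA 0 s
    rw [h0, Matrix.conjTranspose_one, mul_one, one_mul] at this
    exact this

/-- The hyperbolic Darboux curves. -/
noncomputable def hypModel (L : ℝ) : Model L where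
  Curves := HypCurves L
  Vel := HypVel
  energy := energyH L
  Om := omegaH L
  T := tanH
  Sol := PrimSol
  mono hN _ hg := ⟨hg.1, hg.2.1, hg.2.2.1, by
    obtain ⟨R, h1, h2, h3, h4⟩ := hg.2.2.2.1
    exact ⟨R, h1, h2, hN h3, h4⟩, hg.2.2.2.2⟩
  isTangentField := HypCurves.isTangentField
  T_zero hg := by
    obtain ⟨R, -, -, h3, h4⟩ := hg.2.2.2.1
    rw [h4, Set.mem_singleton_iff.1 h3]
    simp
  contDiffOn_T := contDiffOn_tanH
  vel_iff hσ ht := hypVel_iff hσ ht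
  sol_left _ := PrimSol.left
  sol_right := PrimSol.right
  sol_exists _ := PrimSol.exists _
  om_eq hV hW := by
    simp only [omegaH, hV.dd_eq, hW.dd_eq]
    simp
  energy_eq hg := by
    have hT := HypCurves.isTangentField hg
    simp only [energyH, curvatureH]
    rw [dd_eq_deriv_of_contDiff hT.smooth]
    push_cast
    rw [← intervalIntegral.integral_ofReal]
    simp only [sq_sqrt_trH_self (hermitian_deriv hT.smooth hT.herm _)]
  lift _ hg := hyp_lift hg

theorem eq_fieldH_iff (hg : g ∈ HypCurves L SU2) {F : ℝ → M2} :
    F = fieldH g ↔ PrimSol g F (heisenbergField (tanH g)) := by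
  have h := primSol_field g (HypCurves.isTangentField hg).smooth
  exact ⟨fun e => e ▸ h, fun e => e.left h⟩

/-- Equality of the mixed partials of g gives ∂Λ/∂t = (ΛF - FΛ) + i[Λ'', Λ]. The commutator is
skew-Hermitian and the other terms Hermitian, so it must vanish. -/
theorem heisenberg_of_literal_flow {J : Set ℝ} {σ : ℝ → ℝ → M2}
    (hσ : SmoothFamily (HypCurves L SU2) J σ)
    (hF : ∀ t ∈ J, ∀ s, HasDD (fun τ => σ τ s) (σ t s * fieldH (σ t) s) t) :
    Heisenberg Complex.I J fun t => tanH (σ t) := by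
  rw [heisenberg_iff fun t ht => (HypCurves.isTangentField (hσ.2.1 t ht)).smooth]
  intro t ht s
  have hσt := hσ.2.1 t ht
  have hT := HypCurves.isTangentField hσt
  have hf := contDiffOn_family hσ
  have hΛ := contDiffOn_tanH hσ
  set f : ℝ × ℝ → M2 := fun p => σ p.1 p.2 with hf_def
  have hs : ∀ τ ∈ J, ∀ x, pd₂ f (τ, x) = σ τ x * tanH (σ τ) x := fun τ hτ x =>
    (hasDerivAt_snd hσ.1 hf hτ x).unique (HypCurves.hasDerivAt (hσ.2.1 τ hτ) x)
  have ht' : ∀ x, pd₁ f (t, x) = σ t x * fieldH (σ t) x := fun x =>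
    (hasDerivAt_fst hσ.1 hf ht x).unique (hasDD_iff.1 (hF t ht x))
  have hsol := (eq_fieldH_iff hσt).1 rfl
  have hΛt := hasDerivAt_fst hσ.1 hΛ ht s
  set Λ := tanH (σ t)
  set F := fieldH (σ t)
  set D := pd₁ (fun p : ℝ × ℝ => tanH (σ p.1) p.2) (t, s)
  have h12 : pd₁ (pd₂ f) (t, s) = σ t s * F s * Λ s + σ t s * D := by
    refine (hasDerivAt_fst hσ.1 (ContDiffOn.pd₂ hσ.1 hf) ht s).unique
      (((hasDD_iff.1 (hF t ht s)).mul hΛt).congr_of_eventuallyEq ?_)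
    filter_upwards [hσ.1.mem_nhds ht] with τ hτ using hs τ hτ s
  have h21 : pd₂ (pd₁ f) (t, s) = σ t s * Λ s * F s + σ t s * heisenbergField Λ s := by
    refine (hasDerivAt_snd hσ.1 (ContDiffOn.pd₁ hσ.1 hf) ht s).unique ?_
    rw [funext ht']
    exact (HypCurves.hasDerivAt hσt s).mul (hsol.2 s)
  have h3 : F s * Λ s + D = Λ s * F s + heisenbergField Λ s := by
    refine (isUnit_of_det_eq_one (hσt.2.1 s)).mul_left_cancel ?_
    rw [mul_add, mul_add, ← mul_assoc, ← mul_assoc, ← h12, ← h21]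
    exact pd₁_pd₂ hσ.1 hf ht s
  have hH := hT.isVariation_heisenbergField
  have hFh : ∀ x, (F x)ᴴ = F x := by
    -- F* is also a primitive of the Hermitian field i[Λ'', Λ] starting at 0, hence equals F.
    have : PrimSol (σ t) (fun x => (F x)ᴴ) (heisenbergField Λ) := by
      refine ⟨by simp [hsol.1], fun x => ?_⟩
      have := HasDerivAt.conjTranspose (hsol.2 x)
      rwa [hH.herm] at this
    exact congrFun (this.left hsol)
  have hDh : Dᴴ = D := by
    have := isVariation_of_family hσ.1 hΛ
      (fun τ hτ => HypCurves.isTangentField (hσ.2.1 τ hτ)) ht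
    exact this.herm s
  -- Taking adjoints exchanges FΛ and ΛF; in the sum with the original equation the commutator drops
  -- out.
  have h4 := congrArg Matrix.conjTranspose h3
  simp only [Matrix.conjTranspose_add, Matrix.conjTranspose_mul, hFh, hDh, hT.herm, hH.herm] at h4
  have h5 : D = heisenbergField Λ s := by
    have h6 : (2 : ℂ) • D = (2 : ℂ) • heisenbergField Λ s := by
      rw [two_smul, two_smul]
      calc D + D = (F s * Λ s + D) + (Λ s * F s + D) - F s * Λ s - Λ s * F s := by abel
        _ = _ := by rw [h3, h4]; abel
    exact smul_right_injective _ (two_ne_zero) h6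
  rw [← h5]
  exact hΛt

end Hyperbolic

/-! ### Spherical curves, reduced to Hermitian fields by division by i. -/

section Spherical

open scoped Matrix.Norms.Operator

variable {L : ℝ} {X : ℝ → M2} {N : Set M2}

/-- The Hermitian field `Λ / i`. -/
noncomputable def sphT (X : ℝ → M2) (s : ℝ) : M2 := -Complex.I • tanS X s

theorem tanS_eq (X : ℝ → M2) (s : ℝ) : tanS X s = Complex.I • sphT X s := by
  rw [sphT, smul_smul]
  simp

theorem sphT_frame {R : ℝ → M2} (h : ∀ s, tanS X s = R s * A1 * (R s)ᴴ) (s : ℝ) :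
    sphT X s = R s * B1 * (R s)ᴴ := by
  rw [sphT, h, A1_eq, mul_smul_comm, smul_mul_assoc, smul_smul]
  simp

theorem frame_of_sphT {R : ℝ → M2} (h : ∀ s, sphT X s = R s * B1 * (R s)ᴴ) (s : ℝ) :
    tanS X s = R s * A1 * (R s)ᴴ := by
  rw [tanS_eq, h, A1_eq, mul_smul_comm, smul_mul_assoc]

theorem SphCurves.isTangentField (hX : X ∈ SphCurves L SU2) : IsTangentField L (sphT X) := by
  obtain ⟨-, -, -, R, hR, hU, -, hp, hΛ⟩ := hX
  refine isTangentField_of_frame hR hU (sphT_frame hΛ) fun s => ?_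
  rw [sphT_frame hΛ, sphT_frame hΛ, hp s]

theorem SphCurves.mono (hN : N ⊆ SU2) : SphCurves L N ⊆ SphCurves L SU2 := fun X hX => by
  obtain ⟨R, h1, h2, h3, h4⟩ := hX.2.2.2
  exact ⟨hX.1, hX.2.1, hX.2.2.1, R, h1, h2, hN h3, h4⟩

theorem SphCurves.hasDerivAt (hX : X ∈ SphCurves L N) (s : ℝ) :
    HasDerivAt X (X s * tanS X s) s := by
  rw [tanS, ← mul_assoc, SU2.mul_conjTranspose (hX.2.1 s), one_mul,
    dd_eq_deriv_of_contDiff (smoothCurve_iff.1 hX.1)]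
  exact ((smoothCurve_iff.1 hX.1).differentiable (by simp) s).hasDerivAt

theorem SphCurves.skew (hX : X ∈ SphCurves L SU2) (s : ℝ) : (tanS X s)ᴴ = -tanS X s := by
  rw [tanS_eq, Matrix.conjTranspose_smul, (SphCurves.isTangentField hX).herm]
  simp

theorem SphCurves.hasDerivAt_conjTranspose (hX : X ∈ SphCurves L SU2) (s : ℝ) :
    HasDerivAt (fun x => (X x)ᴴ) (-(tanS X s * (X s)ᴴ)) s := by
  have h := HasDerivAt.conjTranspose (SphCurves.hasDerivAt hX s)
  rwa [Matrix.conjTranspose_mul, SphCurves.skew hX, neg_mul] at h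

theorem contDiffOn_tanS {J : Set ℝ} {σ : ℝ → ℝ → M2} (hσ : SmoothFamily (SphCurves L N) J σ) :
    ContDiffOn ℝ ∞ (fun p : ℝ × ℝ => tanS (σ p.1) p.2) (J ×ˢ Set.univ) := by
  have hf := contDiffOn_family hσ
  refine ((contDiffOn_conjTranspose hf).mul (ContDiffOn.pd₂ hσ.1 hf)).congr ?_
  rintro ⟨t, s⟩ ⟨ht, -⟩
  simp only [tanS]
  rw [dd_family hσ ht]

theorem contDiffOn_sphT {J : Set ℝ} {σ : ℝ → ℝ → M2} (hσ : SmoothFamily (SphCurves L N) J σ) :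
    ContDiffOn ℝ ∞ (fun p : ℝ × ℝ => sphT (σ p.1) p.2) (J ×ˢ Set.univ) :=
  (contDiffOn_tanS hσ).const_smul (-Complex.I)

/-- `V(0) = 0` and `dV/ds - [Λ, V] = i v`. -/
def SphSol (X V v : ℝ → M2) : Prop :=
  V 0 = 0 ∧ ∀ s, HasDerivAt V (br (tanS X s) (V s) + Complex.I • v s) s

/-- In the moving frame `X`, the covariant equation becomes a quadrature. -/
theorem hasDerivAt_conj (hX : X ∈ SphCurves L SU2) {V : ℝ → M2} {w : M2} {s : ℝ}
    (hV : HasDerivAt V (br (tanS X s) (V s) + w) s) :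
    HasDerivAt (fun x => X x * V x * (X x)ᴴ) (X s * w * (X s)ᴴ) s := by
  refine (((SphCurves.hasDerivAt hX s).mul hV).mul
    (SphCurves.hasDerivAt_conjTranspose hX s)).congr_deriv ?_
  simp only [br, Pi.mul_apply]
  noncomm_ring

theorem conj_eq_iff (hX : X ∈ SphCurves L SU2) {s : ℝ} {A B : M2} :
    X s * A * (X s)ᴴ = B ↔ A = (X s)ᴴ * B * X s := by
  have h1 := SU2.mul_conjTranspose (hX.2.1 s)
  have h2 := SU2.conjTranspose_mul (hX.2.1 s)
  constructor
  · rintro rfl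
    calc A = ((X s)ᴴ * X s) * A * ((X s)ᴴ * X s) := by rw [h2]; simp
      _ = _ := by noncomm_ring
  · rintro rfl
    calc _ = (X s * (X s)ᴴ) * B * (X s * (X s)ᴴ) := by noncomm_ring
      _ = B := by rw [h1]; simp

theorem SphSol.left (hX : X ∈ SphCurves L SU2) {V W v : ℝ → M2} (hV : SphSol X V v)
    (hW : SphSol X W v) : V = W := by
  have h := eq_of_hasDerivAt_eq (fun s => hasDerivAt_conj hX (hV.2 s))
    (fun s => hasDerivAt_conj hX (hW.2 s)) (by simp [hV.1, hW.1])
  funext s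
  rw [(conj_eq_iff hX).1 (congrFun h s), ← (conj_eq_iff hX).1 rfl]

theorem SphSol.right {V v w : ℝ → M2} (hV : SphSol X V v) (hW : SphSol X V w) : v = w :=
  funext fun s => smul_right_injective M2 Complex.I_ne_zero
    (add_left_cancel ((hV.2 s).unique (hW.2 s)))

/-- The solution is X*(∫X(iv)X*)X, obtained by undoing the conjugation of `hasDerivAt_conj`. -/
theorem SphSol.exists (hX : X ∈ SphCurves L SU2) {v : ℝ → M2} (hv : Continuous v) :
    ∃ V, SphSol X V v := by
  have : CompleteSpace M2 := FiniteDimensional.complete ℝ M2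
  have hc := (smoothCurve_iff.1 hX.1).continuous
  have hcs := (contDiff_conjTranspose (smoothCurve_iff.1 hX.1)).continuous
  have hw : Continuous fun s => X s * (Complex.I • v s) * (X s)ᴴ := by fun_prop
  refine ⟨fun s => (X s)ᴴ * (∫ x in (0 : ℝ)..s, X x * (Complex.I • v x) * (X x)ᴴ) * X s,
    by simp, fun s => ?_⟩
  refine (((SphCurves.hasDerivAt_conjTranspose hX s).mul (hasDerivAt_primitive hw 0 s)).mul
    (SphCurves.hasDerivAt hX s)).congr_deriv ?_
  have h2 := SU2.conjTranspose_mul (hX.2.1 s)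
  have e : (X s)ᴴ * (X s * (Complex.I • v s) * (X s)ᴴ) * X s = Complex.I • v s :=
    ((conj_eq_iff hX).1 rfl).symm
  rw [add_mul, e]
  simp only [br, Pi.mul_apply]
  noncomm_ring

theorem SphSol.defectS_eq {V v : ℝ → M2} (hV : SphSol X V v) (s : ℝ) :
    defectS X V s = Complex.I • v s := by
  rw [defectS, (hasDD_iff.2 (hV.2 s)).dd_eq, add_sub_cancel_left]

/-- The velocity is X*∂X/∂t. Equality of mixed partials yields dV/ds = [Λ, V] + ∂Λ/∂t, and X(0) = I
yields V(0) = 0; the converse is uniqueness for this equation. -/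
theorem sphVel_iff {J : Set ℝ} {σ : ℝ → ℝ → M2} (hσ : SmoothFamily (SphCurves L SU2) J σ)
    {t : ℝ} (ht : t ∈ J) {V : ℝ → M2} :
    SphVel σ t V ↔ SphSol (σ t) V fun s => deriv (fun τ => sphT (σ τ) s) t := by
  have hf := contDiffOn_family hσ
  have hσt := hσ.2.1 t ht
  set f : ℝ × ℝ → M2 := fun p => σ p.1 p.2 with hf_def
  have hs : ∀ τ ∈ J, ∀ x, pd₂ f (τ, x) = σ τ x * tanS (σ τ) x := fun τ hτ x =>
    (hasDerivAt_snd hσ.1 hf hτ x).unique (SphCurves.hasDerivAt (hσ.2.1 τ hτ) x)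
  set V₀ : ℝ → M2 := fun s => (σ t s)ᴴ * pd₁ f (t, s) with hV₀
  have hVel : SphVel σ t V ↔ V = V₀ := by
    have hd := fun s => hasDerivAt_fst hσ.1 hf ht s
    constructor
    · intro h
      funext s
      have e := (hasDD_iff.1 (h s)).unique (hd s)
      rw [hV₀]
      simp only
      rw [← e, ← mul_assoc, SU2.conjTranspose_mul (hσt.2.1 s), one_mul]
    · rintro rfl s
      rw [hasDD_iff, hV₀]
      simp only
      rw [← mul_assoc, SU2.mul_conjTranspose (hσt.2.1 s), one_mul]
      exact hd s
  have hsol : SphSol (σ t) V₀ fun s => deriv (fun τ => sphT (σ τ) s) t := by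
    constructor
    · have : pd₁ f (t, 0) = 0 := by
        refine (hasDerivAt_fst hσ.1 hf ht 0).unique
          ((hasDerivAt_const t (1 : M2)).congr_of_eventuallyEq ?_)
        filter_upwards [hσ.1.mem_nhds ht] with τ hτ using (hσ.2.1 τ hτ).2.2.1
      simp [hV₀, this]
    · intro s
      have hT := (hasDerivAt_fst hσ.1 (contDiffOn_sphT hσ) ht s).differentiableAt.hasDerivAt
      have hΛ : HasDerivAt (fun τ => tanS (σ τ) s)
          (Complex.I • deriv (fun τ => sphT (σ τ) s) t) t :=
        (hT.const_smul Complex.I).congr_of_eventuallyEq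
          (Filter.Eventually.of_forall fun τ => tanS_eq (σ τ) s)
      have h12 : pd₂ (pd₁ f) (t, s) = pd₁ f (t, s) * tanS (σ t) s +
          σ t s * (Complex.I • deriv (fun τ => sphT (σ τ) s) t) := by
        rw [← pd₁_pd₂ hσ.1 hf ht s]
        refine (hasDerivAt_fst hσ.1 (ContDiffOn.pd₂ hσ.1 hf) ht s).unique
          (((hasDerivAt_fst hσ.1 hf ht s).mul hΛ).congr_of_eventuallyEq ?_)
        filter_upwards [hσ.1.mem_nhds ht] with τ hτ using hs τ hτ s
      refine ((SphCurves.hasDerivAt_conjTranspose hσt s).mul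
        (hasDerivAt_snd hσ.1 (ContDiffOn.pd₁ hσ.1 hf) ht s)).congr_deriv ?_
      rw [h12, mul_add, ← mul_assoc _ (σ t s), SU2.conjTranspose_mul (hσt.2.1 s), one_mul]
      simp only [br, hV₀]
      noncomm_ring
  rw [hVel]
  exact ⟨fun h => h ▸ hsol, fun h => SphSol.left hσt h hsol⟩

theorem sph_lift (hN : N ⊆ SU2) (hX : X ∈ SphCurves L N) (S : ℝ → ℝ → M2)
    (hS : ContDiff ℝ ∞ fun p : ℝ × ℝ => S p.1 p.2) (hU : ∀ t s, S t s ∈ SU2)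
    (hp : ∀ t, Function.Periodic (S t) L) (h0 : ∀ s, S 0 s = 1)
    (hSN : ∀ R ∈ N, ∀ t, S t 0 * R ∈ N) :
    ∃ σ : ℝ → ℝ → M2, SmoothFamily (SphCurves L N) Set.univ σ ∧ σ 0 = X ∧
      ∀ t s, sphT (σ t) s = S t s * sphT X s * (S t s)ᴴ := by
  have : CompleteSpace M2 := FiniteDimensional.complete ℝ M2
  have hX' := SphCurves.mono hN hX
  obtain ⟨hXs, hXU, hX0, R, hR, hRU, hRN, hRp, hΛ⟩ := id hX
  have hT := SphCurves.isTangentField hX'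
  set A : ℝ × ℝ → M2 := fun p => Complex.I • (S p.1 p.2 * sphT X p.2 * (S p.1 p.2)ᴴ) with hA
  have hskew : ∀ p, (A p)ᴴ = -A p := fun p => by
    simp [hA, Matrix.conjTranspose_mul, hT.herm, mul_assoc]
  have hAs : ContDiff ℝ ∞ A := (contDiff_rotated hS hT.smooth).const_smul Complex.I
  have hAt : ∀ p, (A p).trace = 0 := fun p => by
    simp only [hA]
    rw [Matrix.trace_smul, Matrix.trace_mul_comm, ← mul_assoc, SU2.conjTranspose_mul (hU _ _),
      one_mul, sphT_frame hΛ, frame_trace (hRU _), smul_zero]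
  obtain ⟨G, hG, hG0, hGd, hGA⟩ := exists_smooth_lift hAs hAt
  have hGU : ∀ t s, G (t, s) ∈ SU2 := by
    intro t s
    refine mem_SU2 ?_ (hGd _)
    -- The coefficient A is skew-Hermitian, so GG* is constant and the lift stays unitary.
    refine congrFun (eq_of_hasDerivAt_eq (V := fun s => G (t, s) * (G (t, s))ᴴ) (D := 0)
      (fun s => ?_) (fun s => hasDerivAt_const s (1 : M2)) (by simp [hG0])) s
    refine ((hGA t s).mul (HasDerivAt.conjTranspose (hGA t s))).congr_deriv ?_
    rw [Matrix.conjTranspose_mul, hskew]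
    simp only [Pi.zero_apply]
    noncomm_ring
  have htan : ∀ t s, sphT (fun s => G (t, s)) s = S t s * sphT X s * (S t s)ᴴ := by
    intro t s
    rw [sphT, tanS, (hasDD_iff.2 (hGA t s)).dd_eq, ← mul_assoc,
      SU2.conjTranspose_mul (hGU t s), one_mul, hA, smul_smul]
    simp
  refine ⟨fun t s => G (t, s), smoothFamily_univ hG fun t =>
    ⟨smoothCurve_iff.2 (hG.comp (contDiff_const.prodMk contDiff_id)), hGU t, hG0 t,
      fun s => S t s * R s, smoothCurve_frame_mul hS hR t, fun s =>
      (Matrix.specialUnitaryGroup (Fin 2) ℂ).mul_mem (hU t s) (hRU s), hSN _ hRN t,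
      fun s => by simp only [hp t s, hRp s], frame_of_sphT fun s => ?_⟩, ?_, htan⟩
  · rw [htan, sphT_frame hΛ, rotated_frame]
  · refine linear_ode_unique (A := tanS X) (fun s => ?_) (SphCurves.hasDerivAt hX)
      (fun s => isUnit_of_det_eq_one (SU2.det (hXU s))) ((hG0 0).trans hX0.symm)
    have := hGA 0 s
    simp only [hA] at this
    rw [h0, Matrix.conjTranspose_one, mul_one, one_mul, ← tanS_eq] at this
    exact this

theorem trK_I_smul_I_smul (A B : M2) : trK (Complex.I • A) (Complex.I • B) = trH A B := by
  simp only [trK, trH, smul_mul_assoc, mul_smul_comm, smul_smul, Complex.I_mul_I,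
    Matrix.trace_smul]
  simp

/-- The spherical Darboux curves. -/
noncomputable def sphModel (L : ℝ) : Model L where
  Curves := SphCurves L
  Vel := SphVel
  energy := energyS L
  Om := omegaS L
  T := sphT
  Sol := SphSol
  mono hN := SphCurves.mono hN
  isTangentField := SphCurves.isTangentField
  T_zero hg := by
    obtain ⟨R, -, -, h3, -, h4⟩ := hg.2.2.2
    rw [sphT_frame h4, Set.mem_singleton_iff.1 h3]
    simp
  contDiffOn_T := contDiffOn_sphT
  vel_iff hσ ht := sphVel_iff hσ ht
  sol_left hX hV hW := SphSol.left hX hV hW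
  sol_right := SphSol.right
  sol_exists hX hv := SphSol.exists hX hv
  om_eq hV hW := by
    simp only [omegaS, hV.defectS_eq, hW.defectS_eq, tanS_eq]
    -- Of the three factors i, the first two convert `trK` into `trH`; the third becomes the
    -- constant in front of the integral.
    simp only [br_smul_left Complex.I, trK_I_smul_I_smul, br_smul_right, trH_smul_right]
    rw [intervalIntegral.integral_const_mul, neg_mul]
  energy_eq {X} hX := by
    have hT := SphCurves.isTangentField hX
    have hd : ∀ s, covS X (tanS X) s = Complex.I • deriv (sphT X) s := fun s => by
      have h := ((hT.smooth.differentiable (by simp) s).hasDerivAt.const_smul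
        Complex.I).congr_of_eventuallyEq (Filter.Eventually.of_forall (tanS_eq X))
      rw [covS, (hasDD_iff.2 h).dd_eq]
      simp [br]
      rfl
    simp only [energyS, curvatureS, hd, trK_I_smul_I_smul]
    push_cast
    rw [← intervalIntegral.integral_ofReal]
    simp only [sq_sqrt_trH_self (hermitian_deriv hT.smooth hT.herm _)]
  lift := sph_lift

theorem dd_dd_tanS (hX : X ∈ SphCurves L SU2) (s : ℝ) :
    dd (dd (tanS X)) s = Complex.I • deriv (deriv (sphT X)) s := by
  have hT := SphCurves.isTangentField hX
  have h1 : dd (tanS X) = fun s => Complex.I • deriv (sphT X) s := funext fun s =>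
    (hasDD_iff.2 (((hT.smooth.differentiable (by simp) s).hasDerivAt.const_smul
      Complex.I).congr_of_eventuallyEq (Filter.Eventually.of_forall (tanS_eq X)))).dd_eq
  rw [h1]
  exact (hasDD_iff.2 (((contDiff_deriv hT.smooth).differentiable (by simp)
    s).hasDerivAt.const_smul Complex.I)).dd_eq

theorem br_dd_dd_tanS (hX : X ∈ SphCurves L SU2) (s : ℝ) :
    br (dd (dd (tanS X)) s) (tanS X s) = Complex.I • heisenbergField (sphT X) s := by
  rw [dd_dd_tanS hX, tanS_eq, br_smul_left, br_smul_right]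
  rfl

theorem br_dd_dd_tanS_eq_zero_iff (hX : X ∈ SphCurves L SU2) (s : ℝ) :
    br (dd (dd (tanS X)) s) (tanS X s) = 0 ↔
      br (deriv (deriv (sphT X)) s) (sphT X s) = 0 := by
  simp [br_dd_dd_tanS hX, heisenbergField]

/-- The inhomogeneous term is -[Λ, Λ''] = [Λ'', Λ], which is i times the Heisenberg field of Λ/i. -/
theorem sphField_iff (hX : X ∈ SphCurves L SU2) {F : ℝ → M2} :
    SphField X F ↔ SphSol X F (heisenbergField (sphT X)) := by
  unfold SphField SphSol
  refine and_congr_right fun _ => forall_congr' fun s => ?_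
  rw [hasDD_iff, ← br_dd_dd_tanS hX, sub_eq_add_neg]
  simp only [br, neg_sub]

theorem existsUnique_sphField (hX : X ∈ SphCurves L SU2) : ∃! F : ℝ → M2, SphField X F := by
  obtain ⟨F, hF⟩ := SphSol.exists hX
    (SphCurves.isTangentField hX).isVariation_heisenbergField.smooth.continuous
  exact ⟨F, (sphField_iff hX).2 hF, fun G hG => SphSol.left hX ((sphField_iff hX).1 hG) hF⟩

theorem heisenberg_tanS_iff {J : Set ℝ} {σ : ℝ → ℝ → M2}
    (hσ : ∀ t ∈ J, σ t ∈ SphCurves L SU2) :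
    Heisenberg 1 J (fun t => tanS (σ t)) ↔
      ∀ t ∈ J, ∀ s, HasDerivAt (fun τ => sphT (σ τ) s) (heisenbergField (sphT (σ t)) s) t := by
  unfold Heisenberg
  refine forall₂_congr fun t ht => forall_congr' fun s => ?_
  rw [hasDD_iff, one_smul, br_dd_dd_tanS (hσ t ht)]
  constructor
  · intro h
    refine (h.const_smul (-Complex.I)).congr_deriv ?_
    rw [smul_smul]
    simp
  · intro h
    exact (h.const_smul Complex.I).congr_of_eventuallyEq
      (Filter.Eventually.of_forall fun τ => tanS_eq (σ τ) s)

end Spherical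

/-! ### Euclidean curves, reconstructed by quadrature. -/

section Euclidean

open scoped Matrix.Norms.Operator

variable {L : ℝ} {x : ℝ → M2} {N : Set M2}

theorem EucCurves.isTangentField (hx : x ∈ EucCurves L SU2) : IsTangentField L (tanE x) := by
  obtain ⟨-, -, R, hR, hU, -, hp, hΛ⟩ := hx
  refine isTangentField_of_frame hR hU hΛ fun s => ?_
  rw [hΛ, hΛ, hp s]

theorem EucCurves.mono (hN : N ⊆ SU2) : EucCurves L N ⊆ EucCurves L SU2 := fun x hx => by
  obtain ⟨R, h1, h2, h3, h4⟩ := hx.2.2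
  exact ⟨hx.1, hx.2.1, R, h1, h2, hN h3, h4⟩

theorem EucCurves.hasDerivAt (hx : x ∈ EucCurves L N) (s : ℝ) : HasDerivAt x (tanE x s) s := by
  rw [tanE, dd_eq_deriv_of_contDiff (smoothCurve_iff.1 hx.1)]
  exact ((smoothCurve_iff.1 hx.1).differentiable (by simp) s).hasDerivAt

theorem contDiffOn_tanE {J : Set ℝ} {σ : ℝ → ℝ → M2} (hσ : SmoothFamily (EucCurves L N) J σ) :
    ContDiffOn ℝ ∞ (fun p : ℝ × ℝ => tanE (σ p.1) p.2) (J ×ˢ Set.univ) :=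
  (ContDiffOn.pd₂ hσ.1 (contDiffOn_family hσ)).congr fun p hp => dd_family hσ hp.1 p.2

/-- Exchange of the two partials of x, with V(0) = 0 because x(0) = 0 throughout the family. -/
theorem eucVel_iff {J : Set ℝ} {σ : ℝ → ℝ → M2} (hσ : SmoothFamily (EucCurves L SU2) J σ)
    {t : ℝ} (ht : t ∈ J) {V : ℝ → M2} :
    EucVel σ t V ↔ PrimSol (σ t) V fun s => deriv (fun τ => tanE (σ τ) s) t := by
  have hf := contDiffOn_family hσ
  set f : ℝ × ℝ → M2 := fun p => σ p.1 p.2 with hf_def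
  have hd := fun s => hasDerivAt_fst hσ.1 hf ht s
  have hVel : EucVel σ t V ↔ V = fun s => pd₁ f (t, s) := by
    constructor
    · exact fun h => funext fun s => (hasDD_iff.1 (h s)).unique (hd s)
    · rintro rfl s
      exact hasDD_iff.2 (hd s)
  have hsol : PrimSol (σ t) (fun s => pd₁ f (t, s))
      fun s => deriv (fun τ => tanE (σ τ) s) t := by
    constructor
    · refine (hd 0).unique ((hasDerivAt_const t (0 : M2)).congr_of_eventuallyEq ?_)
      filter_upwards [hσ.1.mem_nhds ht] with τ hτ using (hσ.2.1 τ hτ).2.1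
    · intro s
      refine (hasDerivAt_snd hσ.1 (ContDiffOn.pd₁ hσ.1 hf) ht s).congr_deriv ?_
      rw [← pd₁_pd₂ hσ.1 hf ht s]
      refine (hasDerivAt_fst hσ.1 (ContDiffOn.pd₂ hσ.1 hf) ht s).unique
        ((hasDerivAt_fst hσ.1 (contDiffOn_tanE hσ) ht
          s).differentiableAt.hasDerivAt.congr_of_eventuallyEq ?_)
      filter_upwards [hσ.1.mem_nhds ht] with τ hτ using (dd_family hσ hτ s).symm
  rw [hVel]
  exact ⟨fun h => h ▸ hsol, fun h => h.left hsol⟩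

theorem euc_lift (hN : N ⊆ SU2) (hx : x ∈ EucCurves L N) (S : ℝ → ℝ → M2)
    (hS : ContDiff ℝ ∞ fun p : ℝ × ℝ => S p.1 p.2) (hU : ∀ t s, S t s ∈ SU2)
    (hp : ∀ t, Function.Periodic (S t) L) (h0 : ∀ s, S 0 s = 1)
    (hSN : ∀ R ∈ N, ∀ t, S t 0 * R ∈ N) :
    ∃ σ : ℝ → ℝ → M2, SmoothFamily (EucCurves L N) Set.univ σ ∧ σ 0 = x ∧
      ∀ t s, tanE (σ t) s = S t s * tanE x s * (S t s)ᴴ := by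
  have : CompleteSpace M2 := FiniteDimensional.complete ℝ M2
  obtain ⟨hxs, hx0, R, hR, hRU, hRN, hRp, hΛ⟩ := id hx
  have hA := contDiff_rotated hS (EucCurves.isTangentField (EucCurves.mono hN hx)).smooth
  set A : ℝ × ℝ → M2 := fun p => S p.1 p.2 * tanE x p.2 * (S p.1 p.2)ᴴ with hA_def
  have hG := contDiff_parametric_primitive hA
  set G : ℝ × ℝ → M2 := fun p => ∫ y in (0 : ℝ)..p.2, A (p.1, y) with hG_def
  have hGA : ∀ t s, HasDerivAt (fun y => G (t, y)) (A (t, s)) s := fun t s =>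
    hasDerivAt_primitive (hA.continuous.comp (continuous_const.prodMk continuous_id)) 0 s
  have hG0 : ∀ t, G (t, 0) = 0 := fun t => by simp [hG_def]
  have htan : ∀ t s, tanE (fun y => G (t, y)) s = S t s * tanE x s * (S t s)ᴴ := fun t s =>
    (hasDD_iff.2 (hGA t s)).dd_eq
  refine ⟨fun t s => G (t, s), smoothFamily_univ hG fun t =>
    ⟨smoothCurve_iff.2 (hG.comp (contDiff_const.prodMk contDiff_id)), hG0 t,
      fun s => S t s * R s, smoothCurve_frame_mul hS hR t, fun s =>
      (Matrix.specialUnitaryGroup (Fin 2) ℂ).mul_mem (hU t s) (hRU s), hSN _ hRN t,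
      fun s => by simp only [hp t s, hRp s], fun s => ?_⟩, ?_, htan⟩
  · rw [htan, hΛ, rotated_frame]
  · refine eq_of_hasDerivAt_eq (fun s => ?_) (EucCurves.hasDerivAt hx) ((hG0 0).trans hx0.symm)
    have := hGA 0 s
    simp only [hA_def] at this
    rw [h0, Matrix.conjTranspose_one, mul_one, one_mul] at this
    exact this

/-- The Euclidean Darboux curves. -/
noncomputable def eucModel (L : ℝ) : Model L where
  Curves := EucCurves L
  Vel := EucVel
  energy := energyE L
  Om := omegaE L
  T := tanE
  Sol := PrimSol
  mono hN := EucCurves.mono hN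
  isTangentField := EucCurves.isTangentField
  T_zero hx := by
    obtain ⟨R, -, -, h3, -, h4⟩ := hx.2.2
    rw [h4, Set.mem_singleton_iff.1 h3]
    simp
  contDiffOn_T := contDiffOn_tanE
  vel_iff hσ ht := eucVel_iff hσ ht
  sol_left _ := PrimSol.left
  sol_right := PrimSol.right
  sol_exists _ := PrimSol.exists _
  om_eq hV hW := by
    simp only [omegaE, hV.dd_eq, hW.dd_eq]
    simp
  energy_eq hx := by
    have hT := EucCurves.isTangentField hx
    simp only [energyE, curvatureE]
    rw [dd_eq_deriv_of_contDiff hT.smooth]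
    push_cast
    rw [← intervalIntegral.integral_ofReal]
    simp only [sq_sqrt_trH_self (hermitian_deriv hT.smooth hT.herm _)]
  lift := euc_lift

theorem eq_fieldE_iff (hx : x ∈ EucCurves L SU2) {F : ℝ → M2} :
    F = fieldE x ↔ PrimSol x F (heisenbergField (tanE x)) := by
  have h := primSol_field x (EucCurves.isTangentField hx).smooth
  exact ⟨fun e => e ▸ h, fun e => e.left h⟩

end Euclidean

/-! ### Assembly of the three cases. -/

theorem eq_horizontal {C : Set M2 → Set (ℝ → M2)} {M : Set (ℝ → M2)}
    (h : M = C {1} ∨ M = C SU2) : ∃ N, N ⊆ SU2 ∧ M = C N := by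
  rcases h with rfl | rfl
  · exact ⟨{1}, one_subset_SU2, rfl⟩
  · exact ⟨SU2, subset_rfl, rfl⟩

end Darboux

theorem mainTheorem4 (L : ℝ) (hL : 0 < L) :
    -- hyperbolic curves
    ((∀ g ∈ HorizPDh L,
        (∀ F : ℝ → M2, IsTangent (HorizPDhFree L) HypVel g F →
          (HamiltonEq (HorizPDh L) HypVel (energyH L) (omegaH L) g F ↔ F = fieldH g)) ∧
        (IsTangent (HorizPDh L) HypVel g (fieldH g) ↔
          br (dd (dd (tanH g)) 0) (tanH g 0) = 0)) ∧
      (∀ g ∈ HorizPDhFree L, ∀ F : ℝ → M2,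
        IsHamiltonianVector (HorizPDhFree L) HypVel (energyH L) (omegaH L) g F ↔
          F = fieldH g) ∧
      (∀ M : Set (ℝ → M2), (M = HorizPDh L ∨ M = HorizPDhFree L) →
        ∀ (J : Set ℝ) (σ : ℝ → ℝ → M2), SmoothFamily M J σ →
          (IsHamiltonianFlow M HypVel (energyH L) (omegaH L) J σ ↔
            Heisenberg Complex.I J (fun t => tanH (σ t)))) ∧
      (∀ (J : Set ℝ) (σ : ℝ → ℝ → M2), SmoothFamily (HorizPDhFree L) J σ →
        (∀ t ∈ J, ∀ s, HasDD (fun τ => σ τ s) (σ t s * fieldH (σ t) s) t) →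
          Heisenberg Complex.I J (fun t => tanH (σ t)))) ∧
    -- spherical curves
    ((∀ X ∈ HorizPDs L,
        (∀ F : ℝ → M2, IsTangent (HorizPDsFree L) SphVel X F →
          (HamiltonEq (HorizPDs L) SphVel (energyS L) (omegaS L) X F ↔ SphField X F)) ∧
        (∀ F : ℝ → M2, SphField X F →
          (IsTangent (HorizPDs L) SphVel X F ↔
            br (dd (dd (tanS X)) 0) (tanS X 0) = 0))) ∧
      (∀ X ∈ HorizPDsFree L,
        (∃! F : ℝ → M2, SphField X F) ∧
        ∀ F : ℝ → M2,
          IsHamiltonianVector (HorizPDsFree L) SphVel (energyS L) (omegaS L) X F ↔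
            SphField X F) ∧
      (∀ M : Set (ℝ → M2), (M = HorizPDs L ∨ M = HorizPDsFree L) →
        ∀ (J : Set ℝ) (σ : ℝ → ℝ → M2), SmoothFamily M J σ →
          (IsHamiltonianFlow M SphVel (energyS L) (omegaS L) J σ ↔
            Heisenberg 1 J (fun t => tanS (σ t))))) ∧
    -- Euclidean curves
    ((∀ x ∈ HorizPDe L,
        (∀ F : ℝ → M2, IsTangent (HorizPDeFree L) EucVel x F →
          (HamiltonEq (HorizPDe L) EucVel (energyE L) (omegaE L) x F ↔ F = fieldE x)) ∧
        (IsTangent (HorizPDe L) EucVel x (fieldE x) ↔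
          br (dd (dd (tanE x)) 0) (tanE x 0) = 0)) ∧
      (∀ x ∈ HorizPDeFree L, ∀ F : ℝ → M2,
        IsHamiltonianVector (HorizPDeFree L) EucVel (energyE L) (omegaE L) x F ↔
          F = fieldE x) ∧
      (∀ M : Set (ℝ → M2), (M = HorizPDe L ∨ M = HorizPDeFree L) →
        ∀ (J : Set ℝ) (σ : ℝ → ℝ → M2), SmoothFamily M J σ →
          (IsHamiltonianFlow M EucVel (energyE L) (omegaE L) J σ ↔
            Heisenberg Complex.I J (fun t => tanE (σ t))))) := by
  refine ⟨⟨fun g hg => ?_, fun g hg F => ?_, ?_, fun J σ hσ => heisenberg_of_literal_flow hσ⟩,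
    ⟨fun X hX => ?_, fun X hX => ?_, ?_⟩, ⟨fun x hx => ?_, fun x hx F => ?_, ?_⟩⟩
  · have hg' := (hypModel L).mono one_subset_SU2 hg
    refine ⟨fun F hF => ?_, ?_⟩
    · exact ((hypModel L).hamiltonEq_iff hL one_subset_SU2 hg hF).trans (eq_fieldH_iff hg').symm
    · rw [dd_dd_eq (HypCurves.isTangentField hg').smooth]
      exact (hypModel L).isTangent_one_iff hg ((eq_fieldH_iff hg').1 rfl)
  · exact ((hypModel L).isHamiltonianVector_iff hL hg).trans (eq_fieldH_iff hg).symm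
  · intro M hM J σ hσ
    obtain ⟨N, hN, rfl⟩ := eq_horizontal (C := HypCurves L) hM
    rw [heisenberg_iff fun t ht =>
      (HypCurves.isTangentField ((hypModel L).mono hN (hσ.2.1 t ht))).smooth]
    exact (hypModel L).isHamiltonianFlow_iff hL hN hσ
  · have hX' := SphCurves.mono one_subset_SU2 hX
    refine ⟨fun F hF => ?_, fun F hF => ?_⟩
    · exact ((sphModel L).hamiltonEq_iff hL one_subset_SU2 hX hF).trans (sphField_iff hX').symm
    · rw [br_dd_dd_tanS_eq_zero_iff hX']
      exact (sphModel L).isTangent_one_iff hX ((sphField_iff hX').1 hF)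
  · exact ⟨existsUnique_sphField hX, fun F =>
      ((sphModel L).isHamiltonianVector_iff hL hX).trans (sphField_iff hX).symm⟩
  · intro M hM J σ hσ
    obtain ⟨N, hN, rfl⟩ := eq_horizontal (C := SphCurves L) hM
    rw [heisenberg_tanS_iff fun t ht => SphCurves.mono hN (hσ.2.1 t ht)]
    exact (sphModel L).isHamiltonianFlow_iff hL hN hσ
  · have hx' := EucCurves.mono one_subset_SU2 hx
    refine ⟨fun F hF => ?_, ?_⟩
    · exact ((eucModel L).hamiltonEq_iff hL one_subset_SU2 hx hF).trans (eq_fieldE_iff hx').symm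
    · rw [dd_dd_eq (EucCurves.isTangentField hx').smooth]
      exact (eucModel L).isTangent_one_iff hx ((eq_fieldE_iff hx').1 rfl)
  · exact ((eucModel L).isHamiltonianVector_iff hL hx).trans (eq_fieldE_iff hx).symm
  · intro M hM J σ hσ
    obtain ⟨N, hN, rfl⟩ := eq_horizontal (C := EucCurves L) hM
    rw [heisenberg_iff fun t ht =>
      (EucCurves.isTangentField (EucCurves.mono hN (hσ.2.1 t ht))).smooth]
    exact (eucModel L).isHamiltonianFlow_iff hL hN hσ
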